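/- Let $\mathbb K$ be a field. An equipped Cardy–Frobenius algebra over $\mathbb K$ is a tuple $((A,l_A),(B,l_B),\phi,U,\star)$ in which: $A$ is a commutative and $B$ an arbitrary finite-dimensional unital associative $\mathbb K$-algebra; $l_A,l_B$ are linear forms such that $(x,y)=l(xy)$ is a non-degenerate symmetric bilinear form; $\phi:A\to B$ is an algebra homomorphism with central image, whose dual $\phi^*:B\to A$, $(\phi^*(b),a)_A=(b,\phi(a))_B$, satisfies the Cardy condition $(\phi^*(x),\phi^*(y))_A=\operatorname{Tr}(b\mapsto xby)$ for all $x,y\in B$; $\star$ denotes linear involutive anti-automorphisms of $A$ and of $B$ with $l_A(a^\star)=l_A(a)$, $l_B(b^\star)=l_B(b)$, $\phi(a^\star)=\phi(a)^\star$; and $U\in A$ satisfies $U^2=K_A^\star$ and $\phi(U)=K_B^\star$, where $K^\star=\sum_{i,j}F^{ij}e_ie_j^\star$ for a basis $(e_i)$ and the inverse $(F^{ij})$ of the matrix $(l(e_ie_j))$. An isomorphism is a pair of algebra isomorphisms $A\cong A'$, $B\cong B'$ respecting $l_A,l_B,\phi,U$ and both maps $\star$. Direct sums and complexifications $H\otimes\mathbb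 C$ are formed componentwise, with all structure maps of $H\otimes\mathbb C$ extended $\mathbb C$-linearly. For a finite group $G$ and $\mathbb K=\mathbb R$ or $\mathbb C$ let $H_G^{\mathbb K}$ be given by $B=\mathbb K[G]$, $l_B(f)=f(1)$, $A=Z(\mathbb K[G])$, $l_A(f)=f(1)/|G|$, $\phi$ the inclusion, $\star$ the linear extension of $g\mapsto g^{-1}$, and $U=\sum_{g\in G}g^2$. For $\mathbb D\in\{\mathbb R,\mathbb C,\mathbb H\}$ with $d=\dim_{\mathbb R}\mathbb D$, an integer $n\ge 1$ and a real $\mu\neq0$ let $H^{\mathbb D}_{n,\mu}$ be given by $B=\operatorname{Mat}_n(\mathbb D)$, $l_B(x)=\mu\operatorname{Re}\operatorname{Tr}(x)$, $A=Z(\mathbb D)$, $l_A(a)=\mu^2\operatorname{Re}(a)/d$, $\phi(a)=a\,\mathrm{Id}$, $a^\star=\overline a$ on $A$, $x^\star=\overline x^{\,t}$ on $B$, and $U=(2-d)/\mu$. Let $\mathrm{Ir}_{\mathbb D}(G)$ be the set of isomorphism classes of irreducible finite-dimensional real representations $\pi$ of $G$ of type $\mathbb D$, that is, with $\operatorname{End}_G(\pi)\cong\mathbb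 D$ as real algebras. **Theorem.** Let $G$ be a finite group. Then $H_G^{\mathbb R}$ and $H_G^{\mathbb C}$ are equipped Cardy–Frobenius algebras over $\mathbb R$ and $\mathbb C$; for every $\mathbb D\in\{\mathbb R,\mathbb C,\mathbb H\}$ and $\pi\in\mathrm{Ir}_{\mathbb D}(G)$ so is $H^{\mathbb D}_{\frac{\dim\pi}{\dim\mathbb D},\frac{\dim\pi}{|G|}}$ over $\mathbb R$; the sets $\mathrm{Ir}_{\mathbb D}(G)$ are finite; and there are isomorphisms of equipped Cardy–Frobenius algebras $$H_G^{\mathbb R}\cong\bigoplus_{\mathbb D=\mathbb R,\mathbb C,\mathbb H}\ \bigoplus_{\pi\in\mathrm{Ir}_{\mathbb D}(G)}H^{\mathbb D}_{\frac{\dim\pi}{\dim\mathbb D},\frac{\dim\pi}{|G|}},\qquad H_G^{\mathbb C}\cong\bigoplus_{\mathbb D=\mathbb R,\mathbb C,\mathbb H}\ \bigoplus_{\pi\in\mathrm{Ir}_{\mathbb D}(G)}H^{\mathbb D}_{\frac{\dim\pi}{\dim\mathbb D},\frac{\dim\pi}{|G|}}\otimes\mathbb C .$$ -/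

import Mathlib

open scoped TensorProduct Quaternion

noncomputable section

namespace CardyFrobenius

universe u v w

/-- The data `((A, l_A), (B, l_B), φ, U, ⋆)` out of which an equipped Cardy--Frobenius algebra over
`K` is formed.  The axioms are collected in `EquippedData.IsEquippedCardyFrobenius`. -/
structure EquippedData (K : Type w) [Field K] where
  A : Type u
  B : Type u
  [commRingA : CommRing A]
  [algebraA : Algebra K A]
  [ringB : Ring B]
  [algebraB : Algebra K B]
  lA : A →ₗ[K] K
  lB : B →ₗ[K] K
  φ : A →ₐ[K] B
  starA : A →ₗ[K] A
  starB : B →ₗ[K] B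
  U : A

attribute [instance] EquippedData.commRingA EquippedData.algebraA EquippedData.ringB
  EquippedData.algebraB

section Frobenius

variable {K : Type w} [Field K] {R : Type u} [Ring R] [Algebra K R]

/-- `(R, l)` is a Frobenius pair: `R` is a finite-dimensional unital algebra and
`(x, y) = l (x * y)` is a non-degenerate symmetric bilinear form (invariance is automatic). -/
structure IsFrobeniusPair (l : R →ₗ[K] K) : Prop where
  finite : Module.Finite K R
  symm : ∀ x y : R, l (x * y) = l (y * x)
  nondegenerate : ∀ x : R, (∀ y : R, l (x * y) = 0) → x = 0

/-- The Gram matrix of the form `(x, y) = l (x * y)` in the basis `b`. -/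
def gram (l : R →ₗ[K] K) {n : ℕ} (b : Module.Basis (Fin n) K R) : Matrix (Fin n) (Fin n) K :=
  Matrix.of fun i j => l (b i * b j)

/-- The twisted Casimir element `K⋆ = ∑ i j, F i j • (b i * (b j)⋆)`, where `F` is the inverse of
the Gram matrix of the form in the basis `b`. -/
def casimirStar (l : R →ₗ[K] K) (star : R →ₗ[K] R) {n : ℕ} (b : Module.Basis (Fin n) K R) : R :=
  ∑ i, ∑ j, (gram l b)⁻¹ i j • (b i * star (b j))

/-- The operator `W x y : b ↦ x * b * y`. -/
def W (x y : R) : R →ₗ[K] R :=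
  LinearMap.mulLeft K x ∘ₗ LinearMap.mulRight K y

/-- `star` is a linear involutive anti-automorphism of the algebra `R`. -/
structure IsAntiInvolution (star : R →ₗ[K] R) : Prop where
  map_mul : ∀ x y : R, star (x * y) = star y * star x
  map_one : star 1 = 1
  involutive : ∀ x : R, star (star x) = x

end Frobenius

namespace EquippedData

/-- The axioms of an equipped Cardy--Frobenius algebra. -/
structure IsEquippedCardyFrobenius {K : Type w} [Field K] (H : EquippedData.{u} K) : Prop where
  frobeniusA : IsFrobeniusPair H.lA
  frobeniusB : IsFrobeniusPair H.lB
  central : ∀ (a : H.A) (b : H.B), H.φ a * b = b * H.φ a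
  /-- The Cardy condition, for the map `φ'` dual to `φ`. -/
  cardy : ∃ φ' : H.B →ₗ[K] H.A,
    (∀ (b : H.B) (a : H.A), H.lA (φ' b * a) = H.lB (b * H.φ a)) ∧
    ∀ x y : H.B, H.lA (φ' x * φ' y) = LinearMap.trace K H.B (W x y)
  antiA : IsAntiInvolution H.starA
  antiB : IsAntiInvolution H.starB
  lA_star : ∀ a : H.A, H.lA (H.starA a) = H.lA a
  lB_star : ∀ b : H.B, H.lB (H.starB b) = H.lB b
  φ_star : ∀ a : H.A, H.φ (H.starA a) = H.starB (H.φ a)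
  U_sq : ∀ (n : ℕ) (b : Module.Basis (Fin n) K H.A), H.U ^ 2 = casimirStar H.lA H.starA b
  φ_U : ∀ (n : ℕ) (b : Module.Basis (Fin n) K H.B), H.φ H.U = casimirStar H.lB H.starB b

/-- Isomorphisms of equipped algebras: pairs of algebra isomorphisms respecting all the data. -/
structure Iso {K : Type w} [Field K] (H : EquippedData.{u} K) (H' : EquippedData.{v} K) where
  eA : H.A ≃ₐ[K] H'.A
  eB : H.B ≃ₐ[K] H'.B
  map_lA : ∀ a : H.A, H'.lA (eA a) = H.lA a
  map_lB : ∀ b : H.B, H'.lB (eB b) = H.lB b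
  map_φ : ∀ a : H.A, eB (H.φ a) = H'.φ (eA a)
  map_starA : ∀ a : H.A, eA (H.starA a) = H'.starA (eA a)
  map_starB : ∀ b : H.B, eB (H.starB b) = H'.starB (eB b)
  map_U : eA H.U = H'.U

/-- The direct sum of a finite family. -/
def directSum {K : Type w} [Field K] {ι : Type v} [Fintype ι] (H : ι → EquippedData.{u} K) :
    EquippedData.{max u v} K where
  A := ∀ i, (H i).A
  B := ∀ i, (H i).B
  lA := ∑ i, (H i).lA ∘ₗ LinearMap.proj i
  lB := ∑ i, (H i).lB ∘ₗ LinearMap.proj i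
  φ := AlgHom.pi fun i => (H i).φ.comp (Pi.evalAlgHom K _ i)
  starA := LinearMap.pi fun i => (H i).starA ∘ₗ LinearMap.proj i
  starB := LinearMap.pi fun i => (H i).starB ∘ₗ LinearMap.proj i
  U := fun i => (H i).U

/-- The complexification `H ⊗ ℂ`; all the structure maps are extended `ℂ`-linearly. -/
def complexify (H : EquippedData.{u} ℝ) : EquippedData.{u} ℂ where
  A := ℂ ⊗[ℝ] H.A
  B := ℂ ⊗[ℝ] H.B
  lA := (Algebra.TensorProduct.rid ℝ ℂ ℂ).toLinearMap ∘ₗ H.lA.baseChange ℂ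
  lB := (Algebra.TensorProduct.rid ℝ ℂ ℂ).toLinearMap ∘ₗ H.lB.baseChange ℂ
  φ := Algebra.TensorProduct.map (AlgHom.id ℂ ℂ) H.φ
  starA := H.starA.baseChange ℂ
  starB := H.starB.baseChange ℂ
  U := 1 ⊗ₜ H.U

end EquippedData

/-! ### The regular algebra of a finite group -/

section Regular

variable (K : Type w) [Field K] (G : Type u) [Group G]

/-- The evaluation `f ↦ f(1)` at the unit of `G`. -/
def evalOne : MonoidAlgebra K G →ₗ[K] K :=
  Finsupp.lapply 1 ∘ₗ (MonoidAlgebra.coeffLinearEquiv K).toLinearMap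

/-- The antipode `g ↦ g⁻¹`. -/
def antipode : MonoidAlgebra K G →ₗ[K] MonoidAlgebra K G :=
  HopfAlgebra.antipode K

lemma antipode_single (g : G) (r : K) :
    antipode K G (MonoidAlgebra.single g r) = MonoidAlgebra.single g⁻¹ r := by
  simp [antipode]

lemma mem_center_of_single {x : MonoidAlgebra K G}
    (h : ∀ g : G, MonoidAlgebra.single g 1 * x = x * MonoidAlgebra.single g 1) :
    x ∈ Subalgebra.center K (MonoidAlgebra K G) := by
  rw [Subalgebra.mem_center_iff]
  intro y
  induction y using MonoidAlgebra.induction_on with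
  | of g => exact h g
  | add a b ha hb => rw [add_mul, mul_add, ha, hb]
  | smul r a ha => rw [smul_mul_assoc, mul_smul_comm, ha]

lemma antipode_mem_center {x : MonoidAlgebra K G}
    (hx : x ∈ Subalgebra.center K (MonoidAlgebra K G)) :
    antipode K G x ∈ Subalgebra.center K (MonoidAlgebra K G) := by
  refine mem_center_of_single K G fun g => ?_
  have hg : MonoidAlgebra.single g 1 = antipode K G (MonoidAlgebra.single g⁻¹ 1) := by
    rw [antipode_single, inv_inv]
  rw [hg, antipode, ← HopfAlgebra.antipode_mul_antidistrib,
    ← HopfAlgebra.antipode_mul_antidistrib, (Subalgebra.mem_center_iff.1 hx) _]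

/-- The element `∑ g, g²` of the group algebra. -/
def sumSq [Fintype G] : MonoidAlgebra K G :=
  ∑ g : G, MonoidAlgebra.single (g ^ 2) 1

lemma sumSq_mem_center [Fintype G] : sumSq K G ∈ Subalgebra.center K (MonoidAlgebra K G) := by
  refine mem_center_of_single K G fun h => ?_
  simp only [sumSq, Finset.mul_sum, Finset.sum_mul, MonoidAlgebra.single_mul_single, mul_one]
  refine Fintype.sum_equiv (MulAut.conj h).toEquiv _ _ fun g => ?_
  congr 1
  simp [pow_two, mul_assoc]

/-- The regular algebra `H_G^K` of the finite group `G`: `B = K[G]`, `l_B(f) = f(1)`, `A` is the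
centre of `B`, `l_A(f) = f(1) / |G|`, `φ` is the inclusion, `⋆` is the antipode and
`U = ∑ g, g²`. -/
def regular [Fintype G] : EquippedData.{max u w} K where
  A := Subalgebra.center K (MonoidAlgebra K G)
  B := MonoidAlgebra K G
  lA := (Fintype.card G : K)⁻¹ •
    (evalOne K G ∘ₗ (Subalgebra.center K (MonoidAlgebra K G)).val.toLinearMap)
  lB := evalOne K G
  φ := (Subalgebra.center K (MonoidAlgebra K G)).val
  starA :=
    { toFun := fun x => ⟨antipode K G x.1, antipode_mem_center K G x.2⟩
      map_add' := fun x y => Subtype.ext (map_add (antipode K G) x.1 y.1)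
      map_smul' := fun r x => Subtype.ext (map_smul (antipode K G) r x.1) }
  starB := antipode K G
  U := ⟨sumSq K G, sumSq_mem_center K G⟩

end Regular

/-! ### The algebras attached to matrices over a real division algebra -/

section Division

variable (D : Type) [DivisionRing D] [Algebra ℝ D] [StarRing D] [StarModule ℝ D]

/-- The conjugation of `D` as a real linear map. -/
def conj : D →ₗ[ℝ] D where
  toFun := star
  map_add' := star_add
  map_smul' r x := by simp [star_smul]

lemma conj_mem_center {x : D} (hx : x ∈ Subalgebra.center ℝ D) :
    conj D x ∈ Subalgebra.center ℝ D := by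
  rw [Subalgebra.mem_center_iff] at hx ⊢
  intro y
  have h := congrArg star (hx (star y))
  simpa [conj] using h.symm

/-- The conjugate transposition of matrices over `D` as a real linear map. -/
def conjTranspose (n : ℕ) : Matrix (Fin n) (Fin n) D →ₗ[ℝ] Matrix (Fin n) (Fin n) D where
  toFun := Matrix.conjTranspose
  map_add' := Matrix.conjTranspose_add
  map_smul' r x := by simp [Matrix.conjTranspose_smul]

/-- The data `H^D_{n,μ}` for a real division algebra `D` with conjugation `star` and real part
`re`, where `d = dim_ℝ D`: `B = Mat_n(D)`, `l_B(x) = μ Re Tr x`, `A = Z(D)`,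
`l_A(a) = μ² Re a / d`, `φ(a) = a Id`, `a⋆` is the conjugate of `a`, `x⋆` is the conjugate
transpose of `x`, and `U = (2 - d) / μ`. -/
def matrixDataOf (re : D →ₗ[ℝ] ℝ) (n : ℕ) (μ : ℝ) : EquippedData.{0} ℝ where
  A := Subalgebra.center ℝ D
  B := Matrix (Fin n) (Fin n) D
  lA := (μ ^ 2 / (Module.finrank ℝ D : ℝ)) • (re ∘ₗ (Subalgebra.center ℝ D).val.toLinearMap)
  lB := μ • (re ∘ₗ Matrix.traceLinearMap (Fin n) ℝ D)
  φ := (Matrix.scalarAlgHom (Fin n) ℝ).comp (Subalgebra.center ℝ D).val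
  starA :=
    { toFun := fun x => ⟨conj D x.1, conj_mem_center D x.2⟩
      map_add' := fun x y => Subtype.ext (map_add (conj D) x.1 y.1)
      map_smul' := fun r x => Subtype.ext (map_smul (conj D) r x.1) }
  starB := conjTranspose D n
  U := algebraMap ℝ (Subalgebra.center ℝ D) ((2 - (Module.finrank ℝ D : ℝ)) / μ)

end Division

instance : StarModule ℝ ℍ[ℝ] := ⟨fun r q => by ext <;> simp⟩

/-- The real part of a quaternion as a real linear map. -/
def quaternionRe : ℍ[ℝ] →ₗ[ℝ] ℝ where
  toFun q := q.re
  map_add' _ _ := rfl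
  map_smul' _ _ := rfl

/-- The three real division algebras `ℝ`, `ℂ`, `ℍ`. -/
inductive DivType : Type
  | real
  | complex
  | quaternionic

/-- `dim_ℝ 𝔻`. -/
def DivType.dim : DivType → ℕ
  | .real => 1
  | .complex => 2
  | .quaternionic => 4

/-- The data `H^𝔻_{n,μ}` for `𝔻 = ℝ, ℂ, ℍ`. -/
def matrixData : DivType → ℕ → ℝ → EquippedData.{0} ℝ
  | .real => matrixDataOf ℝ LinearMap.id
  | .complex => matrixDataOf ℂ Complex.reLm
  | .quaternionic => matrixDataOf ℍ[ℝ] quaternionRe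

/-! ### Irreducible real representations -/

section Irreducible

variable (G : Type u) [Group G]

/-- A finite-dimensional irreducible real representation, written in coordinates. -/
structure RealIrrep where
  dim : ℕ
  ρ : Representation ℝ G (Fin dim → ℝ)
  irreducible : ρ.IsIrreducible

variable {G}

/-- The representation `π` is of type `𝔻` if its algebra of intertwining operators is isomorphic
to `𝔻`. -/
def RealIrrep.HasType (π : RealIrrep G) : DivType → Prop
  | .real => Nonempty (π.ρ.IntertwiningMap π.ρ ≃ₐ[ℝ] ℝ)
  | .complex => Nonempty (π.ρ.IntertwiningMap π.ρ ≃ₐ[ℝ] ℂ)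
  | .quaternionic => Nonempty (π.ρ.IntertwiningMap π.ρ ≃ₐ[ℝ] ℍ[ℝ])

variable (G)

/-- Isomorphism of irreducible real representations. -/
instance RealIrrep.setoid : Setoid (RealIrrep G) where
  r π σ := Nonempty (π.ρ.Equiv σ.ρ)
  iseqv :=
    { refl := fun π => ⟨Representation.Equiv.refl π.ρ⟩
      symm := fun ⟨e⟩ => ⟨e.symm⟩
      trans := fun ⟨e⟩ ⟨f⟩ => ⟨e.trans f⟩ }

/-- The isomorphism classes of irreducible real representations. -/
def IrrepClass : Type u := Quotient (RealIrrep.setoid G)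

variable {G}

/-- The dimension of the representations in an isomorphism class. -/
def IrrepClass.dim (c : IrrepClass G) : ℕ :=
  Quotient.lift RealIrrep.dim (fun π σ (h : Nonempty (π.ρ.Equiv σ.ρ)) => by
    obtain ⟨e⟩ := h
    simpa using LinearEquiv.finrank_eq e.toLinearEquiv) c

variable (G)

/-- `Ir_𝔻(G)`: the isomorphism classes of irreducible real representations of type `𝔻`. -/
def Ir (D : DivType) : Type u :=
  {c : IrrepClass G // ∃ π : RealIrrep G, Quotient.mk (RealIrrep.setoid G) π = c ∧ π.HasType D}

/-- The summand `H^𝔻_{n,μ}` belonging to `π ∈ Ir_𝔻(G)`, with `n = dim π / dim 𝔻` and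
`μ = dim π / |G|`.  The division in `n` is one of natural numbers, and it is exact since `π` is a
vector space over its algebra of intertwining operators. -/
def summand [Fintype G] (x : Σ D : DivType, Ir G D) : EquippedData.{0} ℝ :=
  matrixData x.1 (x.2.1.dim / x.1.dim) ((x.2.1.dim : ℝ) / (Fintype.card G : ℝ))

end Irreducible

end CardyFrobenius

end

/-! Everything is controlled by the algebra `B`. Call families `e`, `f` dual if `x = ∑ l (x * e i) •
f i` for all `x`. The tensor `∑ e i ⊗ f i` does not depend on the choice, `Tr T = ∑ l (T (f i) * e
i)`, and the Cardy condition says that `φ ∘ φ*` is the map `S y = ∑ f i * y * e i`. If `φ` is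
injective, then `φ*` is onto, so `l_A` is determined by `l_A (φ* b) = l_B b`; the image of `φ` is
the whole centre of `B`; and `U` is determined by `φ U = K_B⋆`. Hence an isomorphism of the algebras
`B` that preserves `l_B` and `⋆` extends to the whole structure (`exists_iso_of_equivB`).

It remains to decompose `ℝ[G]` as an algebra with form and involution. On an irreducible `π` fix an
invariant inner product. A symmetric intertwiner has a real eigenvalue, hence is a real scalar by
Schur's lemma, so the adjoint is a positive conjugation on `End_G(π)`. This forces `End_G(π)` to be
`ℝ`, `ℂ` or `ℍ` (`exists_algEquiv`) with its standard conjugation (`map_conj`). The inner product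
then lifts to a `D`-valued Hermitian form, and an orthonormal `D`-basis of `π` gives an
involution-preserving homomorphism `ℝ[G] → Mat_n(D)` with `n = dim π / d` (`exists_matrixForm`). The
product of these homomorphisms is onto by Jacobson density and injective by Maschke's theorem
(`blockHom_bijective`).

The forms agree because both are `|G|⁻¹` times the trace of left multiplication: on `Mat_n(D)` this
trace is `(n d / μ) l_B`, and `n d / μ = |G|` when `μ = dim π / |G|`.

The axioms for the matrix algebras are verified directly; the value of `U` comes from the squares of
the standard units of `D` summing to `2 - d`. For the group algebra the identity `U² = K_A⋆` is
pulled back from the direct sum along the isomorphism (`Iso.isEquipped`). -/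

namespace CardyFrobenius

universe u v w

/-! ### Dual families and Casimir elements -/

section DualFamily

variable {K : Type w} [Field K] {R : Type u} [Ring R] [Algebra K R] {l : R →ₗ[K] K}

/-- The families `e` and `f` are dual with respect to the form `l (x * y)`: every `x` has the
expansion `∑ i, l (x * e i) • f i`. -/
def IsDualFamily {ι : Type*} [Fintype ι] (l : R →ₗ[K] K) (e f : ι → R) : Prop :=
  ∀ x, ∑ i, l (x * e i) • f i = x

namespace IsDualFamily

variable {ι : Type*} [Fintype ι] {e f : ι → R}

lemma eq_zero (h : IsDualFamily l e f) {x : R} (hx : ∀ y, l (x * y) = 0) : x = 0 := by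
  rw [← h x]
  simp [hx]

lemma ext (h : IsDualFamily l e f) {x y : R} (hxy : ∀ z, l (x * z) = l (y * z)) : x = y :=
  sub_eq_zero.1 <| h.eq_zero fun z => by simp [sub_mul, hxy]

/-- Pair the expansion of `z` with `x` and use the symmetry of the form; nondegeneracy, which is
implied by the existence of dual families, removes the test element `z`. -/
lemma swap (h : IsDualFamily l e f) (hs : ∀ x y, l (x * y) = l (y * x)) :
    IsDualFamily l f e := by
  intro x
  refine h.ext fun z => ?_
  have := congrArg (fun t => l (x * t)) (h z)
  simp only [Finset.mul_sum, mul_smul_comm, map_sum, map_smul, smul_eq_mul] at this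
  rw [← this]
  simp only [Finset.sum_mul, smul_mul_assoc, map_sum, map_smul, smul_eq_mul]
  refine Finset.sum_congr rfl fun i _ => ?_
  rw [mul_comm, hs (e i)]

lemma finite (h : IsDualFamily l e f) : Module.Finite K R := by
  refine ⟨(Submodule.fg_def).2 ⟨Set.range f, Set.finite_range f, ?_⟩⟩
  rw [eq_top_iff]
  intro x _
  rw [← h x]
  exact Submodule.sum_mem _ fun i _ => Submodule.smul_mem _ _ (Submodule.subset_span ⟨i, rfl⟩)

lemma isFrobeniusPair (h : IsDualFamily l e f) (hs : ∀ x y, l (x * y) = l (y * x)) :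
    IsFrobeniusPair l :=
  ⟨h.finite, hs, fun _ hx => h.eq_zero hx⟩

/-- The Casimir tensor does not depend on the choice of the dual families. -/
lemma sum_bilin_eq (h : IsDualFamily l e f) (hs : ∀ x y, l (x * y) = l (y * x))
    {κ : Type*} [Fintype κ] {e' f' : κ → R} (h' : IsDualFamily l e' f')
    {M : Type*} [AddCommGroup M] [Module K M] (β : R →ₗ[K] R →ₗ[K] M) :
    ∑ i, β (e i) (f i) = ∑ k, β (e' k) (f' k) := by
  -- Expand `f i` in the second family; by symmetry the coefficients reassemble into the expansion
  -- of `e' k` in the first.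
  calc ∑ i, β (e i) (f i) = ∑ i, β (e i) (∑ k, l (f i * e' k) • f' k) := by simp only [h' _]
    _ = ∑ k, β (∑ i, l (e' k * f i) • e i) (f' k) := by
        simp only [map_sum, map_smul, LinearMap.sum_apply, LinearMap.smul_apply, hs (f _)]
        exact Finset.sum_comm
    _ = ∑ k, β (e' k) (f' k) := by simp only [h.swap hs _]

/-- The dual expansion of `T x` writes `T` as a sum of rank-one operators, whose traces are
evaluations. -/
lemma trace_eq (h : IsDualFamily l e f) (T : R →ₗ[K] R) :
    LinearMap.trace K R T = ∑ i, l (T (f i) * e i) := by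
  have := h.finite
  have hT : T = ∑ i, ((l ∘ₗ LinearMap.mulRight K (e i)) ∘ₗ T).smulRight (f i) := by
    ext x
    simp [h (T x)]
  conv_lhs => rw [hT]
  rw [map_sum]
  simp only [LinearMap.trace_smulRight]
  simp

/-- The elements `∑ i, f i * y * e i` are central. -/
lemma mul_casimir_comm (h : IsDualFamily l e f) (hs : ∀ x y, l (x * y) = l (y * x)) (x y : R) :
    x * ∑ i, f i * y * e i = (∑ i, f i * y * e i) * x := by
  calc x * ∑ i, f i * y * e i = ∑ i, (x * f i) * y * e i := by simp [Finset.mul_sum, mul_assoc]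
    _ = ∑ i, (∑ k, l (x * f i * e k) • f k) * y * e i := by simp only [h _]
    -- The coefficients of `x * f i` in the `f k` are, by cyclicity, those of `e k * x` in the `e
    -- i`, so `x` passes from the left end to the right.
    _ = ∑ k, f k * y * (∑ i, l (e k * x * f i) • e i) := by
        simp only [Finset.sum_mul, Finset.mul_sum, smul_mul_assoc, mul_smul_comm]
        rw [Finset.sum_comm]
        refine Finset.sum_congr rfl fun k _ => Finset.sum_congr rfl fun i _ => ?_
        rw [hs, ← mul_assoc (e k), mul_assoc, mul_assoc]
    _ = (∑ i, f i * y * e i) * x := by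
        simp only [h.swap hs _, Finset.sum_mul]
        simp only [mul_assoc]

/-- Every linear form is represented by an element. -/
lemma exists_repr (h : IsDualFamily l e f) (hs : ∀ x y, l (x * y) = l (y * x)) (m : R →ₗ[K] K) :
    ∃ b, ∀ x, l (b * x) = m x := by
  refine ⟨∑ i, m (e i) • f i, fun x => ?_⟩
  conv_rhs => rw [← h.swap hs x]
  simp only [Finset.sum_mul, smul_mul_assoc, map_sum, map_smul, smul_eq_mul, hs x]
  exact Finset.sum_congr rfl fun i _ => mul_comm _ _

lemma map (h : IsDualFamily l e f) {S : Type v} [Ring S] [Algebra K S] {m : S →ₗ[K] K}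
    (φ : R ≃ₐ[K] S) (hφ : ∀ x, m (φ x) = l x) : IsDualFamily m (φ ∘ e) (φ ∘ f) := by
  intro x
  conv_rhs => rw [← φ.apply_symm_apply x, ← h (φ.symm x)]
  rw [map_sum]
  refine Finset.sum_congr rfl fun i _ => ?_
  rw [map_smul, ← hφ]
  simp

lemma pi {κ : Type*} [Fintype κ] [DecidableEq κ] {R : κ → Type u} [∀ k, Ring (R k)]
    [∀ k, Algebra K (R k)] {l : ∀ k, R k →ₗ[K] K} {ι : κ → Type*} [∀ k, Fintype (ι k)]
    {e f : ∀ k, ι k → R k} (h : ∀ k, IsDualFamily (l k) (e k) (f k)) :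
    IsDualFamily (∑ k, l k ∘ₗ LinearMap.proj k) (fun s : Σ k, ι k => Pi.single s.1 (e s.1 s.2))
      (fun s : Σ k, ι k => Pi.single s.1 (f s.1 s.2)) := by
  have key : ∀ (x : ∀ k, R k) (k : κ) (i : ι k),
      (∑ k, l k ∘ₗ LinearMap.proj k) (x * Pi.single k (e k i)) = l k (x k * e k i) := by
    intro x k i
    simp only [LinearMap.sum_apply, LinearMap.comp_apply, LinearMap.proj_apply]
    rw [Finset.sum_eq_single k]
    · simp
    · intro j _ hj
      simp [hj]
    · simp
  intro x
  rw [Fintype.sum_sigma]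
  simp only [key]
  conv_rhs => rw [← Finset.univ_sum_single x]
  refine Finset.sum_congr rfl fun k _ => ?_
  conv_rhs => rw [← h k (x k)]
  rw [← LinearMap.single_apply (R := K), map_sum]
  simp

lemma baseChange {R : Type u} [Ring R] [Algebra ℝ R] {l : R →ₗ[ℝ] ℝ} {e f : ι → R}
    (h : IsDualFamily l e f) :
    IsDualFamily ((Algebra.TensorProduct.rid ℝ ℂ ℂ).toLinearMap ∘ₗ l.baseChange ℂ)
      (fun i => (1 : ℂ) ⊗ₜ[ℝ] e i) (fun i => (1 : ℂ) ⊗ₜ[ℝ] f i) := by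
  intro x
  induction x using TensorProduct.induction_on with
  | zero => simp
  | add x y hx hy =>
    simp only [add_mul, map_add, add_smul, Finset.sum_add_distrib, hx, hy]
  | tmul z x =>
    conv_rhs => rw [← h x, TensorProduct.tmul_sum]
    refine Finset.sum_congr rfl fun i _ => ?_
    simp [TensorProduct.smul_tmul', TensorProduct.tmul_smul]

lemma isFrobeniusPair_of_comm {A : Type u} [CommRing A] [Algebra K A] {l : A →ₗ[K] K}
    {e f : ι → A} (h : IsDualFamily l e f) : IsFrobeniusPair l :=
  h.isFrobeniusPair fun x y => by rw [mul_comm]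

end IsDualFamily

/-- A kernel vector of the Gram matrix would be the coordinate vector of an element orthogonal to
everything, so the matrix is invertible. The values `l (x * b i)` are the coordinates of `x` times
the Gram matrix, and its inverse recovers the coordinates. -/
lemma IsFrobeniusPair.isDualFamily_gram (h : IsFrobeniusPair l) {n : ℕ}
    (b : Module.Basis (Fin n) K R) :
    IsDualFamily l b (fun i => ∑ j, (gram l b)⁻¹ i j • b j) := by
  have hu : IsUnit (gram l b) := by
    rw [← Matrix.mulVec_injective_iff_isUnit]
    refine (injective_iff_map_eq_zero (Matrix.mulVecLin (gram l b))).2 fun c hc => ?_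
    have h0 : ∑ j, c j • b j = 0 := by
      refine h.nondegenerate _ fun y => ?_
      rw [h.symm, ← b.sum_repr y, Finset.sum_mul, map_sum]
      refine Finset.sum_eq_zero fun i _ => ?_
      have := congrFun hc i
      simp only [Matrix.mulVecLin_apply, Matrix.mulVec, dotProduct, gram, Matrix.of_apply,
        Pi.zero_apply] at this
      simp only [smul_mul_assoc, map_smul, Finset.mul_sum, mul_smul_comm, map_sum, smul_eq_mul]
      simp only [mul_assoc, mul_comm (c _), ← Finset.mul_sum, this, mul_zero]
    funext j
    exact (Fintype.linearIndependent_iff.1 b.linearIndependent) c h0 j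
  intro x
  have hx : ∀ i, l (x * b i) = Matrix.vecMul (b.repr x) (gram l b) i := by
    intro i
    conv_lhs => rw [← b.sum_repr x, Finset.sum_mul, map_sum]
    simp [Matrix.vecMul, dotProduct, gram]
  have hF : Matrix.vecMul (fun i => l (x * b i)) (gram l b)⁻¹ = b.repr x := by
    rw [funext hx]
    simp only [Matrix.vecMul_vecMul]
    rw [Matrix.mul_nonsing_inv _ ((Matrix.isUnit_iff_isUnit_det _).1 hu), Matrix.vecMul_one]
  conv_rhs => rw [← b.sum_repr x, ← hF]
  simp only [Finset.smul_sum, Matrix.vecMul, dotProduct, Finset.sum_smul, smul_smul]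
  exact Finset.sum_comm

lemma IsFrobeniusPair.exists_isDualFamily (h : IsFrobeniusPair l) :
    ∃ (n : ℕ) (e f : Fin n → R), IsDualFamily l e f := by
  have := h.finite
  exact ⟨_, _, _, h.isDualFamily_gram (Module.finBasis K R)⟩

/-- The twisted Casimir element may be computed in any pair of dual families. -/
lemma casimirStar_eq {ι : Type*} [Fintype ι] {e f : ι → R} (h : IsDualFamily l e f)
    (hs : ∀ x y, l (x * y) = l (y * x)) (star : R →ₗ[K] R) {n : ℕ}
    (b : Module.Basis (Fin n) K R) :
    casimirStar l star b = ∑ i, e i * star (f i) := by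
  have := (h.isFrobeniusPair hs).isDualFamily_gram b
  rw [show ∑ i, e i * star (f i) = ∑ i, ((LinearMap.mul K R).compl₂ star) (e i) (f i) by simp,
    h.sum_bilin_eq hs this]
  simp [casimirStar]

end DualFamily

/-! ### Equipped algebras with injective `φ` are determined by `B` -/

namespace EquippedData

variable {K : Type w} [Field K]

/-- The axioms of an equipped Cardy--Frobenius algebra, except `U ^ 2 = K_A⋆`. -/
structure IsStarCardyFrobenius (H : EquippedData.{u} K) : Prop where
  frobeniusA : IsFrobeniusPair H.lA
  frobeniusB : IsFrobeniusPair H.lB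
  central : ∀ (a : H.A) (b : H.B), H.φ a * b = b * H.φ a
  cardy : ∃ φ' : H.B →ₗ[K] H.A,
    (∀ (b : H.B) (a : H.A), H.lA (φ' b * a) = H.lB (b * H.φ a)) ∧
    ∀ x y : H.B, H.lA (φ' x * φ' y) = LinearMap.trace K H.B (W x y)
  antiA : IsAntiInvolution H.starA
  antiB : IsAntiInvolution H.starB
  lA_star : ∀ a : H.A, H.lA (H.starA a) = H.lA a
  lB_star : ∀ b : H.B, H.lB (H.starB b) = H.lB b
  φ_star : ∀ a : H.A, H.φ (H.starA a) = H.starB (H.φ a)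
  φ_U : ∀ (n : ℕ) (b : Module.Basis (Fin n) K H.B), H.φ H.U = casimirStar H.lB H.starB b

lemma IsEquippedCardyFrobenius.isStarCardyFrobenius {H : EquippedData.{u} K}
    (h : H.IsEquippedCardyFrobenius) : H.IsStarCardyFrobenius where
  frobeniusA := h.frobeniusA
  frobeniusB := h.frobeniusB
  central := h.central
  cardy := h.cardy
  antiA := h.antiA
  antiB := h.antiB
  lA_star := h.lA_star
  lB_star := h.lB_star
  φ_star := h.φ_star
  φ_U := h.φ_U

namespace IsStarCardyFrobenius

variable {H : EquippedData.{u} K}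

/-- One pair of dual families suffices for the missing axiom, since the twisted Casimir element does
not depend on the choice. -/
lemma isEquipped (h : H.IsStarCardyFrobenius) {ι : Type*} [Fintype ι] {e f : ι → H.A}
    (hA : IsDualFamily H.lA e f) (hU : H.U ^ 2 = ∑ i, e i * H.starA (f i)) :
    H.IsEquippedCardyFrobenius where
  frobeniusA := h.frobeniusA
  frobeniusB := h.frobeniusB
  central := h.central
  cardy := h.cardy
  antiA := h.antiA
  antiB := h.antiB
  lA_star := h.lA_star
  lB_star := h.lB_star
  φ_star := h.φ_star
  φ_U := h.φ_U
  U_sq n b := by rw [hU, casimirStar_eq hA h.frobeniusA.symm]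

/-- The axioms in terms of dual families; the Cardy condition becomes `φ ∘ φ' = S`, where
`S y = ∑ i, f i * y * e i`. -/
lemma of_dualFamily {κ : Type*} [Fintype κ] {e f : κ → H.B}
    (hA : IsFrobeniusPair H.lA) (hB : IsDualFamily H.lB e f)
    (hs : ∀ x y, H.lB (x * y) = H.lB (y * x))
    (central : ∀ (a : H.A) (b : H.B), H.φ a * b = b * H.φ a)
    (φ' : H.B →ₗ[K] H.A) (hφ' : ∀ (b : H.B) (a : H.A), H.lA (φ' b * a) = H.lB (b * H.φ a))
    (cardy : ∀ y, H.φ (φ' y) = ∑ i, f i * y * e i)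
    (antiA : IsAntiInvolution H.starA) (antiB : IsAntiInvolution H.starB)
    (lA_star : ∀ a : H.A, H.lA (H.starA a) = H.lA a)
    (lB_star : ∀ b : H.B, H.lB (H.starB b) = H.lB b)
    (φ_star : ∀ a : H.A, H.φ (H.starA a) = H.starB (H.φ a))
    (φ_U : H.φ H.U = ∑ i, e i * H.starB (f i)) : H.IsStarCardyFrobenius where
  frobeniusA := hA
  frobeniusB := hB.isFrobeniusPair hs
  central := central
  cardy := by
    refine ⟨φ', hφ', fun x y => ?_⟩
    rw [hφ', cardy, hB.trace_eq]
    simp [W, Finset.mul_sum, mul_assoc]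
  antiA := antiA
  antiB := antiB
  lA_star := lA_star
  lB_star := lB_star
  φ_star := φ_star
  φ_U n b := by rw [casimirStar_eq hB hs, φ_U]

/-- If `φ` is injective, then the map dual to `φ` is surjective, and `φ ∘ φ' = S`. -/
lemma exists_dual (h : H.IsStarCardyFrobenius) {κ : Type*} [Fintype κ] {e f : κ → H.B}
    (hB : IsDualFamily H.lB e f) :
    ∃ φ' : H.B →ₗ[K] H.A, (∀ (b : H.B) (a : H.A), H.lA (φ' b * a) = H.lB (b * H.φ a)) ∧
      (∀ y, H.φ (φ' y) = ∑ i, f i * y * e i) := by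
  obtain ⟨φ', h1, h2⟩ := h.cardy
  refine ⟨φ', h1, fun y => hB.ext fun z => ?_⟩
  -- Duality followed by the Cardy condition gives `l_B (z * φ (φ' y)) = Tr (W z y)`, and the trace
  -- formula turns this into `l_B (z * S y)`.
  rw [h.frobeniusB.symm, ← h1, h2, hB.trace_eq, h.frobeniusB.symm _ z]
  simp [W, Finset.mul_sum, mul_assoc]

lemma dual_surjective (h : H.IsStarCardyFrobenius) (hφ : Function.Injective H.φ)
    {φ' : H.B →ₗ[K] H.A} (hφ' : ∀ (b : H.B) (a : H.A), H.lA (φ' b * a) = H.lB (b * H.φ a)) :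
    Function.Surjective φ' := by
  intro a
  obtain ⟨n, e, f, hB⟩ := h.frobeniusB.exists_isDualFamily
  obtain ⟨m, eA, fA, hA⟩ := h.frobeniusA.exists_isDualFamily
  -- A linear left inverse of `φ` extends the functional `z ↦ l_A (a * z)` to `B`, where it is
  -- represented by some `b`; then `φ' b = a`.
  obtain ⟨ψ, hψ⟩ := LinearMap.exists_leftInverse_of_injective H.φ.toLinearMap
    (LinearMap.ker_eq_bot.2 hφ)
  obtain ⟨b, hb⟩ := hB.exists_repr h.frobeniusB.symm (H.lA ∘ₗ LinearMap.mulLeft K a ∘ₗ ψ)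
  refine ⟨b, hA.ext fun z => ?_⟩
  have := LinearMap.congr_fun hψ z
  simp only [LinearMap.comp_apply, AlgHom.toLinearMap_apply, LinearMap.id_apply] at this
  rw [hφ', hb]
  simp [this]

/-- If `φ` is injective, then its image is the whole centre. -/
lemma mem_range_iff (h : H.IsStarCardyFrobenius) (hφ : Function.Injective H.φ) {b : H.B} :
    b ∈ H.φ.range ↔ ∀ y, b * y = y * b := by
  constructor
  · rintro ⟨a, rfl⟩ y
    exact h.central a y
  · intro hb
    obtain ⟨n, e, f, hB⟩ := h.frobeniusB.exists_isDualFamily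
    obtain ⟨φ', h1, h2⟩ := h.exists_dual hB
    -- With `φ' y = 1`, a central `b` equals `b * S y = S (b * y) = φ (φ' (b * y))`.
    obtain ⟨y, hy⟩ := h.dual_surjective hφ h1 1
    refine ⟨φ' (b * y), ?_⟩
    have : H.φ (φ' (b * y)) = b * H.φ (φ' y) := by
      rw [h2, h2, Finset.mul_sum]
      refine Finset.sum_congr rfl fun i _ => ?_
      rw [← mul_assoc, ← mul_assoc, ← mul_assoc, hb]
    simpa [hy] using this

end IsStarCardyFrobenius

/-- If the maps `φ` are injective, an isomorphism of the algebras `B` that respects the forms and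
the involutions extends to an isomorphism of the whole structure. -/
lemma exists_iso_of_equivB {H : EquippedData.{u} K} {H' : EquippedData.{v} K}
    (h : H.IsStarCardyFrobenius) (h' : H'.IsStarCardyFrobenius)
    (hφ : Function.Injective H.φ) (hφ' : Function.Injective H'.φ) (eB : H.B ≃ₐ[K] H'.B)
    (hl : ∀ b, H'.lB (eB b) = H.lB b) (hstar : ∀ b, eB (H.starB b) = H'.starB (eB b)) :
    Nonempty (Iso H H') := by
  -- Both images are centres, and an algebra isomorphism carries centre to centre; this yields the
  -- map on `A`.
  have hmem : ∀ b, eB b ∈ H'.φ.range ↔ b ∈ H.φ.range := by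
    intro b
    rw [h.mem_range_iff hφ, h'.mem_range_iff hφ']
    constructor
    · intro hb y
      apply eB.injective
      simpa using hb (eB y)
    · intro hb y
      obtain ⟨y, rfl⟩ := eB.surjective y
      rw [← map_mul, hb, map_mul]
  let g : H.A →ₐ[K] H'.A := (AlgEquiv.ofInjective H'.φ hφ').symm.toAlgHom.comp
    ((eB.toAlgHom.comp H.φ).codRestrict H'.φ.range fun a => (hmem _).2 ⟨a, rfl⟩)
  have hg : ∀ a, H'.φ (g a) = eB (H.φ a) := by
    intro a
    have := congrArg Subtype.val ((AlgEquiv.ofInjective H'.φ hφ').apply_symm_apply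
      ((eB.toAlgHom.comp H.φ).codRestrict H'.φ.range (fun a => (hmem _).2 ⟨a, rfl⟩) a))
    exact this
  have hbij : Function.Bijective g := by
    constructor
    · intro x y hxy
      apply hφ
      apply eB.injective
      rw [← hg, ← hg, hxy]
    · intro y
      obtain ⟨b, hb⟩ := eB.surjective (H'.φ y)
      obtain ⟨a, rfl⟩ := (hmem b).1 (hb ▸ ⟨y, rfl⟩)
      exact ⟨a, hφ' ((hg a).trans hb)⟩
  obtain ⟨n, e, f, hB⟩ := h.frobeniusB.exists_isDualFamily
  have hB' := hB.map eB hl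
  obtain ⟨φ₁, h1, h2⟩ := h.exists_dual hB
  obtain ⟨φ₂, h1', h2'⟩ := h'.exists_dual hB'
  refine ⟨⟨AlgEquiv.ofBijective g hbij, eB, ?_, hl, fun a => (hg a).symm, ?_, hstar, ?_⟩⟩
  · intro a
    -- Every element of `A` has the form `φ' b`, and `l_A (φ' b) = l_B b`, so preserving `l_B`
    -- forces preserving `l_A`.
    obtain ⟨b, rfl⟩ := h.dual_surjective hφ h1 a
    have hgb : g (φ₁ b) = φ₂ (eB b) := by
      apply hφ'
      rw [hg, h2, h2']
      simp
    have e1 := h1 b 1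
    have e2 := h1' (eB b) 1
    simp only [map_one, mul_one] at e1 e2
    rw [AlgEquiv.coe_ofBijective, hgb, e1, e2, hl]
  · intro a
    apply hφ'
    rw [AlgEquiv.coe_ofBijective, hg, h.φ_star, hstar, h'.φ_star, hg]
  -- `φ U` is the twisted Casimir element, and `eB` carries dual families to dual families.
  · apply hφ'
    have := h.frobeniusB.finite
    have b := Module.finBasis K H.B
    have := h'.frobeniusB.finite
    have b' := Module.finBasis K H'.B
    rw [AlgEquiv.coe_ofBijective, hg, h.φ_U _ b, h'.φ_U _ b',
      casimirStar_eq hB h.frobeniusB.symm, casimirStar_eq hB' h'.frobeniusB.symm]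
    simp [hstar]

/-- The axiom `U ^ 2 = K_A⋆` is transported along isomorphisms. -/
lemma Iso.isEquipped {H : EquippedData.{u} K} {H' : EquippedData.{v} K} (E : Iso H H')
    (h : H.IsStarCardyFrobenius) (h' : H'.IsEquippedCardyFrobenius) :
    H.IsEquippedCardyFrobenius := by
  obtain ⟨n, e, f, hA⟩ := h.frobeniusA.exists_isDualFamily
  have hA' := hA.map E.eA E.map_lA
  refine h.isEquipped hA (E.eA.injective ?_)
  have := h'.frobeniusA.finite
  have b' := Module.finBasis K H'.A
  rw [map_pow, E.map_U, h'.U_sq _ b', casimirStar_eq hA' h'.frobeniusA.symm]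
  simp [E.map_starA]

/-! ### Direct sums -/

section Pi

variable {ι : Type v} [Fintype ι] {R : ι → Type u} [∀ i, Ring (R i)] [∀ i, Algebra K (R i)]

lemma sum_proj_apply (l : ∀ i, R i →ₗ[K] K) (x : ∀ i, R i) :
    (∑ i, l i ∘ₗ LinearMap.proj i : (∀ i, R i) →ₗ[K] K) x = ∑ i, l i (x i) := by
  simp

variable [DecidableEq ι] {κ : ι → Type*} [∀ i, Fintype (κ i)]

lemma sum_sigma_single (x : ∀ i, κ i → R i) :
    ∑ s : Σ i, κ i, Pi.single (M := R) s.1 (x s.1 s.2) = fun i => ∑ j, x i j := by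
  rw [Fintype.sum_sigma, ← Finset.univ_sum_single (M := R) (fun i => ∑ j, x i j)]
  refine Finset.sum_congr rfl fun i _ => ?_
  exact (map_sum (AddMonoidHom.single R i) _ _).symm

/-- Each summand lives in a single component, so a Casimir sum over the disjoint union of the
families is the tuple of the Casimir sums of the components. -/
lemma sum_single_mul_pi_single (s : ∀ i, R i →ₗ[K] R i) (x y : ∀ i, κ i → R i) :
    ∑ t : Σ i, κ i, Pi.single (M := R) t.1 (x t.1 t.2) *
      LinearMap.pi (fun i => s i ∘ₗ LinearMap.proj i) (Pi.single (M := R) t.1 (y t.1 t.2)) =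
        fun i => ∑ j, x i j * s i (y i j) := by
  rw [← sum_sigma_single]
  refine Finset.sum_congr rfl fun t _ => funext fun j => ?_
  obtain rfl | hj := eq_or_ne j t.1
  · simp
  · simp [hj]

lemma sum_single_mul_mul_single (x y : ∀ i, κ i → R i) (z : ∀ i, R i) :
    ∑ t : Σ i, κ i, Pi.single (M := R) t.1 (x t.1 t.2) * z * Pi.single (M := R) t.1 (y t.1 t.2) =
        fun i => ∑ j, x i j * z i * y i j := by
  rw [← sum_sigma_single]
  refine Finset.sum_congr rfl fun t _ => funext fun j => ?_
  obtain rfl | hj := eq_or_ne j t.1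
  · simp
  · simp [hj]

end Pi

lemma IsEquippedCardyFrobenius.directSum {ι : Type v} [Fintype ι] {H : ι → EquippedData.{u} K}
    (h : ∀ i, (H i).IsEquippedCardyFrobenius) :
    (EquippedData.directSum H).IsEquippedCardyFrobenius := by
  classical
  have hB := fun i => (h i).frobeniusB.exists_isDualFamily
  choose n e f hB using hB
  have hA := fun i => (h i).frobeniusA.exists_isDualFamily
  choose m eA fA hA using hA
  have hd := fun i => (h i).isStarCardyFrobenius.exists_dual (hB i)
  choose φ' h1 h2 using hd
  have hlA : ∀ a, (EquippedData.directSum H).lA a = ∑ i, (H i).lA (a i) := sum_proj_apply _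
  have hlB : ∀ a, (EquippedData.directSum H).lB a = ∑ i, (H i).lB (a i) := sum_proj_apply _
  refine IsStarCardyFrobenius.isEquipped (H := EquippedData.directSum H)
    (IsStarCardyFrobenius.of_dualFamily (H := EquippedData.directSum H)
      (IsDualFamily.pi hA).isFrobeniusPair_of_comm (IsDualFamily.pi hB) ?_ ?_
      (LinearMap.pi fun i => φ' i ∘ₗ LinearMap.proj i) ?_ ?_ ?_ ?_ ?_ ?_ ?_ ?_)
    (IsDualFamily.pi hA) ?_
  · intro x y
    rw [hlB, hlB]
    exact Finset.sum_congr rfl fun i _ => (h i).frobeniusB.symm (x i) (y i)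
  · exact fun a b => funext fun i => (h i).central _ _
  · intro b a
    rw [hlA, hlB]
    exact Finset.sum_congr rfl fun i _ => h1 i (b i) (a i)
  · intro y
    exact (funext fun i => h2 i (y i)).trans
      (sum_single_mul_mul_single (R := fun i => (H i).B) f e y).symm
  · exact ⟨fun x y => funext fun i => (h i).antiA.map_mul _ _,
      funext fun i => (h i).antiA.map_one, fun x => funext fun i => (h i).antiA.involutive _⟩
  · exact ⟨fun x y => funext fun i => (h i).antiB.map_mul _ _,
      funext fun i => (h i).antiB.map_one, fun x => funext fun i => (h i).antiB.involutive _⟩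
  · intro a
    rw [hlA, hlA]
    exact Finset.sum_congr rfl fun i _ => (h i).lA_star (a i)
  · intro a
    rw [hlB, hlB]
    exact Finset.sum_congr rfl fun i _ => (h i).lB_star (a i)
  · exact fun a => funext fun i => (h i).φ_star _
  · refine Eq.trans (funext fun i => ?_)
      (sum_single_mul_pi_single (R := fun i => (H i).B) (fun i => (H i).starB) e f).symm
    have := (h i).frobeniusB.finite
    rw [← casimirStar_eq (hB i) (h i).frobeniusB.symm _ (Module.finBasis K (H i).B), ← (h i).φ_U]
    rfl
  · refine Eq.trans (funext fun i => ?_)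
      (sum_single_mul_pi_single (R := fun i => (H i).A) (fun i => (H i).starA) eA fA).symm
    have := (h i).frobeniusA.finite
    rw [← casimirStar_eq (hA i) (h i).frobeniusA.symm _ (Module.finBasis K (H i).A), ← (h i).U_sq]
    rfl

lemma directSum_φ_injective {ι : Type v} [Fintype ι] {H : ι → EquippedData.{u} K}
    (h : ∀ i, Function.Injective (H i).φ) : Function.Injective (EquippedData.directSum H).φ :=
  fun _ _ hxy => funext fun i => h i (congrFun hxy i)

/-! ### Complexification -/

section Complexify

variable {R : Type u} [Ring R] [Algebra ℝ R]

lemma baseChange_form_tmul (l : R →ₗ[ℝ] ℝ) (z : ℂ) (x : R) :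
    ((Algebra.TensorProduct.rid ℝ ℂ ℂ).toLinearMap ∘ₗ l.baseChange ℂ) (z ⊗ₜ[ℝ] x) =
      (l x : ℂ) * z := by
  simp

lemma baseChange_form_mul_comm {l : R →ₗ[ℝ] ℝ} (hs : ∀ x y, l (x * y) = l (y * x))
    (x y : ℂ ⊗[ℝ] R) :
    ((Algebra.TensorProduct.rid ℝ ℂ ℂ).toLinearMap ∘ₗ l.baseChange ℂ) (x * y) =
      ((Algebra.TensorProduct.rid ℝ ℂ ℂ).toLinearMap ∘ₗ l.baseChange ℂ) (y * x) := by
  induction x using TensorProduct.induction_on with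
  | zero => simp
  | add x₁ x₂ h₁ h₂ => rw [add_mul, mul_add, map_add, map_add, h₁, h₂]
  | tmul z x =>
    induction y using TensorProduct.induction_on with
    | zero => simp
    | add x₁ x₂ h₁ h₂ => rw [add_mul, mul_add, map_add, map_add, h₁, h₂]
    | tmul w y =>
      rw [Algebra.TensorProduct.tmul_mul_tmul, Algebra.TensorProduct.tmul_mul_tmul,
        baseChange_form_tmul, baseChange_form_tmul, hs, mul_comm z]

lemma _root_.CardyFrobenius.IsAntiInvolution.baseChange {s : R →ₗ[ℝ] R} (h : IsAntiInvolution s) :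
    IsAntiInvolution (s.baseChange ℂ) where
  map_mul x y := by
    induction x using TensorProduct.induction_on with
    | zero => simp
    | add x₁ x₂ h₁ h₂ => rw [add_mul, map_add, map_add, h₁, h₂, mul_add]
    | tmul z x =>
      induction y using TensorProduct.induction_on with
      | zero => simp
      | add x₁ x₂ h₁ h₂ => rw [mul_add, map_add, map_add, h₁, h₂, add_mul]
      | tmul w y => simp [h.map_mul, mul_comm z]
  map_one := by simp [Algebra.TensorProduct.one_def, h.map_one]
  involutive x := by
    induction x using TensorProduct.induction_on with
    | zero => simp
    | add x₁ x₂ h₁ h₂ => rw [map_add, map_add, h₁, h₂]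
    | tmul z x => simp [h.involutive]

lemma baseChange_form_star {l : R →ₗ[ℝ] ℝ} {s : R →ₗ[ℝ] R} (h : ∀ x, l (s x) = l x)
    (x : ℂ ⊗[ℝ] R) :
    ((Algebra.TensorProduct.rid ℝ ℂ ℂ).toLinearMap ∘ₗ l.baseChange ℂ) (s.baseChange ℂ x) =
      ((Algebra.TensorProduct.rid ℝ ℂ ℂ).toLinearMap ∘ₗ l.baseChange ℂ) x := by
  induction x using TensorProduct.induction_on with
  | zero => simp
  | add x₁ x₂ h₁ h₂ => rw [map_add, map_add, map_add, h₁, h₂]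
  | tmul z x => rw [LinearMap.baseChange_tmul, baseChange_form_tmul, baseChange_form_tmul, h]

end Complexify

/-- The families `1 ⊗ e i` and `1 ⊗ f i` remain dual and every structure map is `ℂ`-linear, so each
axiom reduces to the real one on pure tensors. -/
lemma IsEquippedCardyFrobenius.complexify {H : EquippedData.{u} ℝ}
    (h : H.IsEquippedCardyFrobenius) : H.complexify.IsEquippedCardyFrobenius := by
  obtain ⟨n, e, f, hB⟩ := h.frobeniusB.exists_isDualFamily
  obtain ⟨m, eA, fA, hA⟩ := h.frobeniusA.exists_isDualFamily
  obtain ⟨φ', h1, h2⟩ := h.isStarCardyFrobenius.exists_dual hB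
  refine IsStarCardyFrobenius.isEquipped (H := H.complexify)
    (IsStarCardyFrobenius.of_dualFamily (H := H.complexify)
      hA.baseChange.isFrobeniusPair_of_comm hB.baseChange
      (baseChange_form_mul_comm h.frobeniusB.symm) ?_
      (φ'.baseChange ℂ) ?_ ?_ (.baseChange h.antiA) (.baseChange h.antiB)
      (baseChange_form_star h.lA_star) (baseChange_form_star h.lB_star) ?_ ?_)
    hA.baseChange ?_
  · show ∀ (a : ℂ ⊗[ℝ] H.A) (b : ℂ ⊗[ℝ] H.B),
      Algebra.TensorProduct.map (AlgHom.id ℂ ℂ) H.φ a * b =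
        b * Algebra.TensorProduct.map (AlgHom.id ℂ ℂ) H.φ a
    intro a b
    induction a using TensorProduct.induction_on with
    | zero => simp
    | add x₁ x₂ h₁ h₂ => rw [map_add, add_mul, mul_add, h₁, h₂]
    | tmul z x =>
      induction b using TensorProduct.induction_on with
      | zero => simp
      | add x₁ x₂ h₁ h₂ => rw [add_mul, mul_add, h₁, h₂]
      | tmul w y => simp [h.central, mul_comm z]
  · show ∀ (b : ℂ ⊗[ℝ] H.B) (a : ℂ ⊗[ℝ] H.A),
      ((Algebra.TensorProduct.rid ℝ ℂ ℂ).toLinearMap ∘ₗ H.lA.baseChange ℂ)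
        (φ'.baseChange ℂ b * a) =
      ((Algebra.TensorProduct.rid ℝ ℂ ℂ).toLinearMap ∘ₗ H.lB.baseChange ℂ)
        (b * Algebra.TensorProduct.map (AlgHom.id ℂ ℂ) H.φ a)
    intro b a
    induction a using TensorProduct.induction_on with
    | zero => simp
    | add x₁ x₂ h₁ h₂ => rw [map_add, mul_add, mul_add, map_add, map_add, h₁, h₂]
    | tmul z x =>
      induction b using TensorProduct.induction_on with
      | zero => simp
      | add x₁ x₂ h₁ h₂ => rw [map_add, add_mul, add_mul, map_add, map_add, h₁, h₂]
      | tmul w y => simp [h1]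
  · show ∀ y : ℂ ⊗[ℝ] H.B,
      Algebra.TensorProduct.map (AlgHom.id ℂ ℂ) H.φ (φ'.baseChange ℂ y) =
        ∑ i, ((1 : ℂ) ⊗ₜ[ℝ] f i) * y * ((1 : ℂ) ⊗ₜ[ℝ] e i)
    intro y
    induction y using TensorProduct.induction_on with
    | zero => simp
    | add x₁ x₂ h₁ h₂ =>
      rw [map_add, map_add, h₁, h₂, ← Finset.sum_add_distrib]
      simp only [mul_add, add_mul]
    | tmul w y => simp [h2, TensorProduct.tmul_sum]
  · show ∀ a : ℂ ⊗[ℝ] H.A,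
      Algebra.TensorProduct.map (AlgHom.id ℂ ℂ) H.φ (H.starA.baseChange ℂ a) =
        H.starB.baseChange ℂ (Algebra.TensorProduct.map (AlgHom.id ℂ ℂ) H.φ a)
    intro a
    induction a using TensorProduct.induction_on with
    | zero => simp
    | add x₁ x₂ h₁ h₂ => simp only [map_add, h₁, h₂]
    | tmul z x => simp [h.φ_star]
  · show Algebra.TensorProduct.map (AlgHom.id ℂ ℂ) H.φ ((1 : ℂ) ⊗ₜ[ℝ] H.U) =
      ∑ i, ((1 : ℂ) ⊗ₜ[ℝ] e i) * H.starB.baseChange ℂ ((1 : ℂ) ⊗ₜ[ℝ] f i)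
    have := h.frobeniusB.finite
    have hU := h.φ_U _ (Module.finBasis ℝ H.B)
    rw [casimirStar_eq hB h.frobeniusB.symm] at hU
    simp [hU, TensorProduct.tmul_sum]
  · have := h.frobeniusA.finite
    have hU := h.U_sq _ (Module.finBasis ℝ H.A)
    rw [casimirStar_eq hA h.frobeniusA.symm] at hU
    have key : ((1 : ℂ) ⊗ₜ[ℝ] H.U : ℂ ⊗[ℝ] H.A) ^ 2 =
        ∑ i, ((1 : ℂ) ⊗ₜ[ℝ] eA i) * H.starA.baseChange ℂ ((1 : ℂ) ⊗ₜ[ℝ] fA i) := by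
      rw [Algebra.TensorProduct.tmul_pow, one_pow, hU]
      refine (TensorProduct.tmul_sum _ _ _).trans (Finset.sum_congr rfl fun i _ => ?_)
      simp
    exact key

lemma complexify_φ_injective {H : EquippedData.{u} ℝ} (h : Function.Injective H.φ) :
    Function.Injective H.complexify.φ :=
  Module.Flat.lTensor_preserves_injective_linearMap (M := ℂ) H.φ.toLinearMap h

end EquippedData

/-! ### The group algebra -/

section Regular

variable (K : Type w) [Field K] (G : Type u) [Group G]

lemma evalOne_single [DecidableEq G] (g : G) (r : K) :
    evalOne K G (MonoidAlgebra.single g r) = if g = 1 then r else 0 := by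
  simp [evalOne, Finsupp.single_apply]

lemma evalOne_mul_comm (x y : MonoidAlgebra K G) :
    evalOne K G (x * y) = evalOne K G (y * x) := by
  induction x using MonoidAlgebra.induction_linear with
  | zero => simp
  | add a b ha hb => rw [add_mul, mul_add, map_add, map_add, ha, hb]
  | single g r =>
    induction y using MonoidAlgebra.induction_linear with
    | zero => simp
    | add a b ha hb => rw [add_mul, mul_add, map_add, map_add, ha, hb]
    | single h s =>
      classical
      rw [MonoidAlgebra.single_mul_single, MonoidAlgebra.single_mul_single, evalOne_single,
        evalOne_single, mul_comm r]
      simp only [mul_eq_one_iff_inv_eq (a := g), mul_eq_one_iff_eq_inv (a := h), eq_comm (a := h)]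

lemma evalOne_antipode (x : MonoidAlgebra K G) :
    evalOne K G (antipode K G x) = evalOne K G x := by
  induction x using MonoidAlgebra.induction_linear with
  | zero => simp
  | add a b ha hb => rw [map_add, map_add, map_add, ha, hb]
  | single g r =>
    classical
    rw [antipode_single, evalOne_single, evalOne_single]
    simp only [inv_eq_one]

lemma isAntiInvolution_antipode : IsAntiInvolution (antipode K G) where
  map_mul x y := HopfAlgebra.antipode_mul_antidistrib x y
  map_one := HopfAlgebra.antipode_one
  involutive x := by
    induction x using MonoidAlgebra.induction_linear with
    | zero => simp
    | add a b ha hb => rw [map_add, map_add, ha, hb]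
    | single g r => rw [antipode_single, antipode_single, inv_inv]

variable [Fintype G]

lemma isDualFamily_group : IsDualFamily (evalOne K G) (fun g => MonoidAlgebra.single g 1)
    (fun g => MonoidAlgebra.single g⁻¹ 1) := by
  classical
  intro x
  induction x using MonoidAlgebra.induction_linear with
  | zero => simp
  | add a b ha hb => simp only [add_mul, map_add, add_smul, Finset.sum_add_distrib, ha, hb]
  | single g r =>
    rw [Finset.sum_eq_single g⁻¹]
    · simp [MonoidAlgebra.single_mul_single, evalOne_single]
    · intro h _ hh
      rw [MonoidAlgebra.single_mul_single, evalOne_single, if_neg, zero_smul]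
      exact fun h' => hh (eq_inv_of_mul_eq_one_right h')
    · simp

/-- Twice averaging against a central element changes nothing but the factor `|G|`. -/
lemma evalOne_casimir_mul {a : MonoidAlgebra K G}
    (ha : a ∈ Subalgebra.center K (MonoidAlgebra K G)) (y : MonoidAlgebra K G) :
    evalOne K G ((∑ g : G, MonoidAlgebra.single g⁻¹ 1 * y * MonoidAlgebra.single g 1) * a) =
      (Fintype.card G : K) * evalOne K G (y * a) := by
  rw [Finset.sum_mul, map_sum]
  have : ∀ g : G, evalOne K G (MonoidAlgebra.single g⁻¹ 1 * y * MonoidAlgebra.single g 1 * a) =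
      evalOne K G (y * a) := by
    intro g
    rw [mul_assoc, Subalgebra.mem_center_iff.1 ha (MonoidAlgebra.single g 1), evalOne_mul_comm,
      mul_assoc, ← mul_assoc (MonoidAlgebra.single g 1), MonoidAlgebra.single_mul_single,
      mul_inv_cancel, mul_one, ← MonoidAlgebra.one_def, one_mul, evalOne_mul_comm]
  simp [this]

/-- The averaging map `y ↦ ∑ g, g⁻¹ * y * g` into the centre. -/
noncomputable def centralize :
    MonoidAlgebra K G →ₗ[K] Subalgebra.center K (MonoidAlgebra K G) where
  toFun y := ⟨∑ g : G, MonoidAlgebra.single g⁻¹ 1 * y * MonoidAlgebra.single g 1,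
    Subalgebra.mem_center_iff.2 fun x =>
      (isDualFamily_group K G).mul_casimir_comm (evalOne_mul_comm K G) x y⟩
  map_add' x y := Subtype.ext <| by simp [mul_add, add_mul, Finset.sum_add_distrib]
  map_smul' r x := Subtype.ext <| by simp [Finset.smul_sum]

/-- With the normalisation `l_A = |G|⁻¹ f(1)`, averaging over conjugation is exactly the dual of the
inclusion of the centre, and it is also the map `S`, which is the Cardy condition. The group
elements and their inverses are dual families, so `K_B⋆ = ∑ g * (g⁻¹)⋆ = ∑ g²`. -/
lemma regular_isStarCardyFrobenius (hG : (Fintype.card G : K) ≠ 0) :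
    (regular K G).IsStarCardyFrobenius := by
  have hB := isDualFamily_group K G
  have hs := evalOne_mul_comm K G
  have := hB.finite
  have key : ∀ (b : MonoidAlgebra K G) (a : Subalgebra.center K (MonoidAlgebra K G)),
      (Fintype.card G : K)⁻¹ * evalOne K G (centralize K G b * a) = evalOne K G (b * a) := by
    intro b a
    rw [← inv_mul_cancel_left₀ hG (evalOne K G (b * a))]
    exact congrArg _ (evalOne_casimir_mul K G a.2 b)
  have key' : ∀ (b : MonoidAlgebra K G) (a : Subalgebra.center K (MonoidAlgebra K G)),
      (Fintype.card G : K)⁻¹ * evalOne K G (a * centralize K G b) = evalOne K G (a * b) := by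
    intro b a
    rw [hs, key, hs]
  refine EquippedData.IsStarCardyFrobenius.of_dualFamily (H := regular K G) ⟨?_, ?_, ?_⟩ hB hs ?_
    (centralize K G) ?_ ?_ ?_ (isAntiInvolution_antipode K G) ?_ (evalOne_antipode K G) ?_ ?_
  · exact inferInstanceAs (Module.Finite K
      (Subalgebra.toSubmodule (Subalgebra.center K (MonoidAlgebra K G))))
  · intro x y
    rw [mul_comm]
  · intro a ha
    -- A central element orthogonal to all averages `centralize y` is orthogonal to every `y`.
    exact Subtype.ext (hB.eq_zero (x := a.1) fun y =>
      (key' y a).symm.trans (ha (centralize K G y)))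
  · intro a b
    exact (Subalgebra.mem_center_iff.1 a.2 b).symm
  · exact key
  · exact fun y => rfl
  · have h := isAntiInvolution_antipode K G
    refine ⟨fun x y => Subtype.ext (h.map_mul x.1 y.1), Subtype.ext h.map_one,
      fun x => Subtype.ext (h.involutive x.1)⟩
  · intro a
    exact congrArg (fun t => (Fintype.card G : K)⁻¹ * t) (evalOne_antipode K G a.1)
  · exact fun a => rfl
  · show sumSq K G = ∑ g : G, MonoidAlgebra.single g 1 * antipode K G (MonoidAlgebra.single g⁻¹ 1)
    simp [sumSq, antipode_single, MonoidAlgebra.single_mul_single, pow_two]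

lemma regular_φ_injective : Function.Injective (regular K G).φ :=
  Subtype.val_injective

end Regular

/-! ### Matrix algebras over the real division algebras -/

section Division

variable {D : Type} [DivisionRing D] [Algebra ℝ D] [StarRing D] [StarModule ℝ D]

/-- The conjugation of the centre of `D`. -/
noncomputable def conjCenter : Subalgebra.center ℝ D →ₗ[ℝ] Subalgebra.center ℝ D where
  toFun x := ⟨conj D x.1, conj_mem_center D x.2⟩
  map_add' x y := Subtype.ext (map_add (conj D) x.1 y.1)
  map_smul' r x := Subtype.ext (map_smul (conj D) r x.1)

lemma conjCenter_conjCenter (x : Subalgebra.center ℝ D) : conjCenter (conjCenter x) = x :=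
  Subtype.ext (star_star x.1)

/-- The properties of the conjugation, of the real part, and of the standard orthonormal bases `u`
of `D` and `z` of its centre, for `D = ℝ, ℂ, ℍ`. -/
structure IsConjugationAlgebra (re : D →ₗ[ℝ] ℝ) {d : ℕ} (u : Fin d → D) {c : ℕ}
    (z : Fin c → Subalgebra.center ℝ D) : Prop where
  finrank_eq : Module.finrank ℝ D = d
  re_mul_comm : ∀ x y, re (x * y) = re (y * x)
  re_star : ∀ x, re (star x) = re x
  star_add_self : ∀ x, star x + x = algebraMap ℝ D (2 * re x)
  star_mul_unit : ∀ a, star (u a) * u a = 1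
  dual : IsDualFamily re u (fun a => star (u a))
  sum_sq : ∑ a, u a * u a = algebraMap ℝ D (2 - d)
  dual_center : IsDualFamily (re ∘ₗ (Subalgebra.center ℝ D).val.toLinearMap) z
    (fun k => conjCenter (z k))
  sum_sq_center : (d : ℝ) • ∑ k, z k * z k = algebraMap ℝ (Subalgebra.center ℝ D) ((2 - d) ^ 2)

namespace IsConjugationAlgebra

variable {re : D →ₗ[ℝ] ℝ} {d : ℕ} {u : Fin d → D} {c : ℕ} {z : Fin c → Subalgebra.center ℝ D}

lemma unit_mul_star (h : IsConjugationAlgebra re u z) (a : Fin d) : u a * star (u a) = 1 :=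
  mul_eq_one_comm.1 (h.star_mul_unit a)

lemma dim_ne_zero (h : IsConjugationAlgebra re u z) : (d : ℝ) ≠ 0 := by
  have := h.dual.finite
  rw [← h.finrank_eq]
  exact_mod_cast Module.finrank_pos.ne'

/-- The map `x ↦ ∑ a, (u a)⋆ * x * u a` into the centre. -/
noncomputable def average (h : IsConjugationAlgebra re u z) : D →ₗ[ℝ] Subalgebra.center ℝ D where
  toFun x := ⟨∑ a, star (u a) * x * u a, Subalgebra.mem_center_iff.2 fun y =>
    h.dual.mul_casimir_comm h.re_mul_comm y x⟩
  map_add' x y := Subtype.ext <| by simp [mul_add, add_mul, Finset.sum_add_distrib]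
  map_smul' r x := Subtype.ext <| by simp [Finset.smul_sum]

lemma re_average_mul (h : IsConjugationAlgebra re u z) (x : D) (y : Subalgebra.center ℝ D) :
    re (h.average x * y : D) = d * re (x * y) := by
  show re ((∑ a, star (u a) * x * u a) * y) = _
  rw [Finset.sum_mul, map_sum]
  have : ∀ a, re (star (u a) * x * u a * y) = re (x * y) := by
    intro a
    rw [mul_assoc, Subalgebra.mem_center_iff.1 y.2, h.re_mul_comm, ← mul_assoc, mul_assoc y.1,
      h.unit_mul_star, mul_one, h.re_mul_comm]
  simp [this]

variable {n : ℕ} {μ : ℝ}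

lemma isDualFamily_matrix (h : IsConjugationAlgebra re u z) (hμ : μ ≠ 0) :
    IsDualFamily (μ • (re ∘ₗ Matrix.traceLinearMap (Fin n) ℝ D))
      (fun t : (Fin n × Fin n) × Fin d => Matrix.single t.1.1 t.1.2 (u t.2))
      (fun t => μ⁻¹ • Matrix.single t.1.2 t.1.1 (star (u t.2))) := by
  intro x
  have : ∀ (i j : Fin n) (a : Fin d),
      (μ • (re ∘ₗ Matrix.traceLinearMap (Fin n) ℝ D)) (x * Matrix.single i j (u a)) =
        μ * re (x j i * u a) := by
    intro i j a
    simp [Matrix.trace_mul_single]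
  simp only [Fintype.sum_prod_type, this, smul_smul]
  conv_rhs => rw [Matrix.matrix_eq_sum_single x]
  rw [Finset.sum_comm]
  refine Finset.sum_congr rfl fun j _ => Finset.sum_congr rfl fun i _ => ?_
  conv_rhs => rw [← h.dual (x j i)]
  rw [← Matrix.singleAddMonoidHom_apply, map_sum]
  refine Finset.sum_congr rfl fun a _ => ?_
  rw [mul_right_comm, mul_inv_cancel₀ hμ, one_mul, Matrix.singleAddMonoidHom_apply,
    Matrix.smul_single]

/-- Since `E_ji y E_ij = y_ii E_jj`, the sum over `i` produces the trace, the sum over `j` the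
identity matrix, and the sum over the units averages the trace into the centre of `D`. -/
lemma matrix_casimir (h : IsConjugationAlgebra re u z) (y : Matrix (Fin n) (Fin n) D) :
    ∑ t : (Fin n × Fin n) × Fin d, (μ⁻¹ • Matrix.single t.1.2 t.1.1 (star (u t.2))) * y *
      Matrix.single t.1.1 t.1.2 (u t.2) =
        Matrix.scalar (Fin n) (μ⁻¹ • (h.average y.trace : D)) := by
  have : ∀ (i j : Fin n) (a : Fin d), (μ⁻¹ • Matrix.single j i (star (u a))) * y *
      Matrix.single i j (u a) = Matrix.single j j (μ⁻¹ • (star (u a) * y i i * u a)) := by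
    intro i j a
    rw [← Matrix.smul_single, smul_mul_assoc, smul_mul_assoc, Matrix.single_mul_mul_single]
  simp only [Fintype.sum_prod_type, this]
  rw [Finset.sum_comm]
  ext k l
  simp only [Matrix.sum_apply, Matrix.single_apply, Matrix.scalar_apply, Matrix.diagonal_apply]
  by_cases hkl : k = l
  · subst hkl
    simp only [and_self, if_true]
    rw [Finset.sum_eq_single k (fun j _ hj => by simp [hj]) (by simp)]
    simp only [if_true]
    show _ = μ⁻¹ • ∑ a, star (u a) * y.trace * u a
    rw [Finset.sum_comm, Finset.smul_sum]
    refine Finset.sum_congr rfl fun a _ => ?_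
    simp [Matrix.trace, Finset.mul_sum, Finset.sum_mul, Finset.smul_sum]
  · rw [if_neg hkl]
    refine Finset.sum_eq_zero fun j _ => Finset.sum_eq_zero fun i _ =>
      Finset.sum_eq_zero fun a _ => if_neg ?_
    rintro ⟨rfl, rfl⟩
    exact hkl rfl

lemma matrix_form_mul_comm (h : IsConjugationAlgebra re u z) (x y : Matrix (Fin n) (Fin n) D) :
    (μ • (re ∘ₗ Matrix.traceLinearMap (Fin n) ℝ D)) (x * y) =
      (μ • (re ∘ₗ Matrix.traceLinearMap (Fin n) ℝ D)) (y * x) := by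
  simp only [LinearMap.smul_apply, LinearMap.comp_apply, Matrix.traceLinearMap_apply,
    Matrix.trace, Matrix.diag, Matrix.mul_apply, map_sum]
  rw [Finset.sum_comm]
  simp only [h.re_mul_comm (x _ _)]

/-- The trace is the pairing with the Casimir element `∑ f t * e t`, which is the scalar `n d / μ`
because `star (u a) * u a = 1`. This constant later identifies the form on a block with the one of
the group algebra. -/
lemma trace_mulLeft (h : IsConjugationAlgebra re u z) (hμ : μ ≠ 0)
    (x : Matrix (Fin n) (Fin n) D) :
    LinearMap.trace ℝ _ (LinearMap.mulLeft ℝ x) = (n * d / μ) *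
      (μ • (re ∘ₗ Matrix.traceLinearMap (Fin n) ℝ D)) x := by
  have hc := h.matrix_casimir (μ := μ) (1 : Matrix (Fin n) (Fin n) D)
  have h1 : (h.average (1 : Matrix (Fin n) (Fin n) D).trace : D) = algebraMap ℝ D (n * d) := by
    show ∑ a, star (u a) * (1 : Matrix (Fin n) (Fin n) D).trace * u a = _
    simp only [Matrix.trace_one, Fintype.card_fin, (Nat.cast_commute n _).eq.symm, mul_assoc,
      h.star_mul_unit]
    simp [mul_comm]
  rw [(h.isDualFamily_matrix hμ).trace_eq]
  simp only [LinearMap.mulLeft_apply, mul_assoc]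
  rw [← map_sum, ← Finset.mul_sum]
  simp only [mul_one, h1] at hc
  have hx : x * Matrix.scalar (Fin n) (μ⁻¹ • algebraMap ℝ D (n * d)) = (n * d / μ : ℝ) • x := by
    ext i j
    rw [Matrix.scalar_apply, Matrix.mul_diagonal, Matrix.smul_apply, Algebra.smul_def, ← map_mul,
      ← Algebra.commutes, ← Algebra.smul_def, div_eq_inv_mul]
  rw [hc, hx, map_smul, smul_eq_mul]

lemma isEquipped (h : IsConjugationAlgebra re u z) (hμ : μ ≠ 0) :
    (matrixDataOf D re n μ).IsEquippedCardyFrobenius := by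
  have hd := h.dim_ne_zero
  -- The factor `d / μ²` inverts the normalisation `μ² / d` of `l_A`.
  have hA : IsDualFamily (matrixDataOf D re n μ).lA z
      (fun k => (d / μ ^ 2 : ℝ) • conjCenter (z k)) := by
    have key : ∀ x : Subalgebra.center ℝ D, ∑ k,
        ((μ ^ 2 / (Module.finrank ℝ D : ℝ)) * re (x * z k : Subalgebra.center ℝ D).1) •
          ((d / μ ^ 2 : ℝ) • conjCenter (z k)) = x := by
      intro x
      refine Eq.trans (Finset.sum_congr rfl fun k _ => ?_) (h.dual_center x)
      rw [smul_smul, h.finrank_eq]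
      congr 1
      field_simp
      rfl
    exact key
  refine EquippedData.IsStarCardyFrobenius.isEquipped (H := matrixDataOf D re n μ)
    (EquippedData.IsStarCardyFrobenius.of_dualFamily (H := matrixDataOf D re n μ)
      hA.isFrobeniusPair_of_comm (h.isDualFamily_matrix hμ) h.matrix_form_mul_comm ?_
      (μ⁻¹ • (h.average ∘ₗ Matrix.traceLinearMap (Fin n) ℝ D)) ?_ ?_ ?_ ?_ ?_ ?_ ?_ ?_) hA ?_
  · show ∀ (a : Subalgebra.center ℝ D) (b : Matrix (Fin n) (Fin n) D),
      Matrix.scalar (Fin n) a.1 * b = b * Matrix.scalar (Fin n) a.1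
    intro a b
    exact (Matrix.scalar_commute a.1 (fun r => (Subalgebra.mem_center_iff.1 a.2 r).symm) b).eq
  · show ∀ (b : Matrix (Fin n) (Fin n) D) (a : Subalgebra.center ℝ D),
      (μ ^ 2 / (Module.finrank ℝ D : ℝ)) * re ((μ⁻¹ • (h.average b.trace : D)) * a.1) =
        μ * re (b * Matrix.scalar (Fin n) a.1).trace
    intro b a
    rw [smul_mul_assoc, map_smul, h.re_average_mul, h.finrank_eq]
    have : (b * Matrix.scalar (Fin n) a.1).trace = b.trace * a.1 := by
      simp [Matrix.trace, Finset.sum_mul]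
    rw [this, smul_eq_mul]
    field_simp
  · exact fun y => (h.matrix_casimir y).symm
  · refine ⟨fun x y => Subtype.ext ?_, Subtype.ext ?_, fun x => Subtype.ext ?_⟩
    · exact star_mul x.1 y.1
    · exact star_one D
    · exact star_star x.1
  · exact ⟨Matrix.conjTranspose_mul, Matrix.conjTranspose_one, Matrix.conjTranspose_conjTranspose⟩
  · intro a
    exact congrArg (fun t => (μ ^ 2 / (Module.finrank ℝ D : ℝ)) * t) (h.re_star a.1)
  · intro b
    refine congrArg (fun t => μ * t) ((congrArg re ?_).trans (h.re_star _))
    exact Matrix.trace_conjTranspose b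
  · show ∀ a : Subalgebra.center ℝ D,
      Matrix.scalar (Fin n) (star a.1) = (Matrix.scalar (Fin n) a.1).conjTranspose
    intro a
    simp [Matrix.diagonal_conjTranspose]
  · show Matrix.scalar (Fin n) (algebraMap ℝ D ((2 - (Module.finrank ℝ D : ℝ)) / μ)) =
      ∑ t : (Fin n × Fin n) × Fin d, Matrix.single t.1.1 t.1.2 (u t.2) *
        (μ⁻¹ • Matrix.single t.1.2 t.1.1 (star (u t.2))).conjTranspose
    -- The second factor is `μ⁻¹ E_ij u`, so only `i = j` survives, and the sum of the squares of
    -- the units yields `(2 - d) / μ`.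
    have : ∀ (i j : Fin n) (a : Fin d), Matrix.single i j (u a) *
        (μ⁻¹ • Matrix.single j i (star (u a))).conjTranspose =
          if i = j then Matrix.single i i (μ⁻¹ • (u a * u a)) else 0 := by
      intro i j a
      rw [Matrix.conjTranspose_smul, Matrix.conjTranspose_single, star_star, mul_smul_comm]
      split_ifs with hij
      · subst hij
        rw [Matrix.single_mul_single_same, Matrix.smul_single]
        simp
      · rw [Matrix.single_mul_single_of_ne _ _ _ _ (Ne.symm hij), smul_zero]
    have hsum : μ⁻¹ • ∑ a, u a * u a = algebraMap ℝ D ((2 - d) / μ) := by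
      rw [h.sum_sq, Algebra.smul_def, ← map_mul, div_eq_inv_mul]
    simp only [Fintype.sum_prod_type, this, h.finrank_eq, ← hsum]
    ext k l
    simp only [Matrix.sum_apply, Matrix.scalar_apply, Matrix.diagonal_apply, Finset.smul_sum]
    by_cases hkl : k = l
    · subst hkl
      rw [if_pos rfl, Finset.sum_eq_single k, Finset.sum_eq_single k]
      · simp
      · intro j _ hj
        simp [hj.symm]
      · simp
      · intro i _ hi
        refine Finset.sum_eq_zero fun j _ => Finset.sum_eq_zero fun a _ => ?_
        split_ifs
        · exact Matrix.single_apply_of_ne _ _ _ _ _ fun h => hi h.1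
        · rfl
      · simp
    · rw [if_neg hkl]
      refine (Finset.sum_eq_zero fun i _ => Finset.sum_eq_zero fun j _ =>
        Finset.sum_eq_zero fun a _ => ?_).symm
      split_ifs
      · refine Matrix.single_apply_of_ne _ _ _ _ _ ?_
        rintro ⟨rfl, rfl⟩
        exact hkl rfl
      · rfl
  -- The conjugation undoes the one in the dual family, so `K_A⋆ = (d / μ²) ∑ z_k² = ((2 - d) /
  -- μ)²`.
  · have : ∀ k, z k * conjCenter ((d / μ ^ 2 : ℝ) • conjCenter (z k)) =
        (1 / μ ^ 2 : ℝ) • (d : ℝ) • (z k * z k) := by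
      intro k
      rw [map_smul, conjCenter_conjCenter, mul_smul_comm, smul_smul]
      congr 1
      ring
    have key : (algebraMap ℝ (Subalgebra.center ℝ D) ((2 - (Module.finrank ℝ D : ℝ)) / μ)) ^ 2 =
        ∑ k, z k * conjCenter ((d / μ ^ 2 : ℝ) • conjCenter (z k)) := by
      simp only [this]
      rw [← Finset.smul_sum, ← Finset.smul_sum, h.sum_sq_center, ← map_pow, h.finrank_eq,
        Algebra.smul_def, ← map_mul]
      congr 1
      ring
    exact key

lemma φ_injective (hn : n ≠ 0) : Function.Injective (matrixDataOf D re n μ).φ := by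
  intro x y hxy
  have : Matrix.scalar (Fin n) x.1 = Matrix.scalar (Fin n) y.1 := hxy
  have : Nonempty (Fin n) := ⟨0, Nat.pos_of_ne_zero hn⟩
  exact Subtype.ext (Matrix.scalar_inj.1 ‹Matrix.scalar (Fin n) x.1 = _›)

end IsConjugationAlgebra

/-- Over `ℝ`, `ℂ`, `ℍ` the squares of the standard units sum to `1`, `0`, `-2`, which is `2 - d`
each time; `d` times the sum of squares of the basis of the centre is `1`, `0`, `4`, which is `(2 -
d)²`. -/
lemma isConjugationAlgebra_real :
    IsConjugationAlgebra (D := ℝ) LinearMap.id ![1] ![1] where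
  finrank_eq := by simp
  re_mul_comm := mul_comm
  re_star _ := rfl
  star_add_self x := by simp; ring
  star_mul_unit a := by fin_cases a; simp
  dual x := by simp
  sum_sq := by simp; norm_num
  dual_center x := by
    apply Subtype.ext
    simp [conjCenter, conj]
  sum_sq_center := by
    apply Subtype.ext
    simp only [Subalgebra.coe_algebraMap]
    simp
    norm_num

lemma isConjugationAlgebra_complex :
    IsConjugationAlgebra (D := ℂ) Complex.reLm ![1, Complex.I]
      ![1, ⟨Complex.I, Subalgebra.mem_center_iff.2 fun x => mul_comm x Complex.I⟩] where
  finrank_eq := by simp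
  re_mul_comm x y := by rw [mul_comm]
  re_star _ := rfl
  star_add_self x := by apply Complex.ext <;> simp; ring
  star_mul_unit a := by fin_cases a <;> simp
  dual x := by apply Complex.ext <;> simp
  sum_sq := by simp
  dual_center x := by
    apply Subtype.ext
    apply Complex.ext <;> simp [conjCenter, conj]
  sum_sq_center := by
    apply Subtype.ext
    simp

lemma quaternionRe_apply (q : ℍ[ℝ]) : quaternionRe q = q.re := rfl

/-- The quaternion with the given coordinates. -/
def quaternionOf (a b c d : ℝ) : ℍ[ℝ] := ⟨a, b, c, d⟩

@[simp] lemma quaternionOf_re (a b c d : ℝ) : (quaternionOf a b c d).re = a := rfl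

@[simp] lemma quaternionOf_imI (a b c d : ℝ) : (quaternionOf a b c d).imI = b := rfl

@[simp] lemma quaternionOf_imJ (a b c d : ℝ) : (quaternionOf a b c d).imJ = c := rfl

@[simp] lemma quaternionOf_imK (a b c d : ℝ) : (quaternionOf a b c d).imK = d := rfl

/-- The standard basis `1, i, j, k` of the quaternions. -/
def quaternionUnit : Fin 4 → ℍ[ℝ] :=
  ![1, quaternionOf 0 1 0 0, quaternionOf 0 0 1 0, quaternionOf 0 0 0 1]

lemma isConjugationAlgebra_quaternion :
    IsConjugationAlgebra (D := ℍ[ℝ]) quaternionRe quaternionUnit ![1] where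
  finrank_eq := by exact QuaternionAlgebra.finrank_eq_four _ _ _
  re_mul_comm x y := by simp only [quaternionRe_apply, Quaternion.re_mul]; ring
  re_star x := by simp [quaternionRe_apply]
  star_add_self x := by ext <;> simp [quaternionRe_apply]; ring
  star_mul_unit a := by fin_cases a <;> ext <;> simp [quaternionUnit]
  dual x := by ext <;> simp [Fin.sum_univ_four, quaternionRe_apply, quaternionUnit]
  sum_sq := by ext <;> simp [Fin.sum_univ_four, quaternionUnit]; norm_num
  dual_center x := by
    -- Commuting with `i` and `j` kills all three imaginary coordinates, so a central quaternion is
    -- real.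
    have h1 : ∀ y, y * x.1 = x.1 * y := Subalgebra.mem_center_iff.1 x.2
    have h2 := h1 (quaternionOf 0 1 0 0)
    have h3 := h1 (quaternionOf 0 0 1 0)
    apply Subtype.ext
    simp only [Quaternion.ext_iff, Quaternion.re_mul, Quaternion.imI_mul, Quaternion.imJ_mul,
      Quaternion.imK_mul, quaternionOf_re, quaternionOf_imI, quaternionOf_imJ,
      quaternionOf_imK] at h2 h3
    ext <;> simp [conjCenter, conj, quaternionRe_apply]
    · linarith
    · linarith
    · linarith
  sum_sq_center := by
    apply Subtype.ext
    rw [show ((2 : ℝ) - (4 : ℕ)) ^ 2 = 4 by norm_num]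
    simp only [Subalgebra.coe_algebraMap]
    ext <;> simp

end Division

/-! ### Real algebras with a positive conjugation -/

section PositiveInvolution

variable {E : Type u} [Ring E] [Algebra ℝ E]

/-- `s` is an anti-involution of `E` whose symmetric elements are the real scalars, and
`s x * x` is a positive scalar for `x ≠ 0`. -/
structure IsPositiveConjugation (s : E →ₗ[ℝ] E) : Prop extends IsAntiInvolution s where
  nontrivial : Nontrivial E
  exists_real : ∀ x, s x = x → ∃ r : ℝ, x = algebraMap ℝ E r
  exists_pos : ∀ x, x ≠ 0 → ∃ r : ℝ, 0 < r ∧ s x * x = algebraMap ℝ E r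

namespace IsPositiveConjugation

variable {s : E →ₗ[ℝ] E}

lemma map_algebraMap (h : IsPositiveConjugation s) (r : ℝ) :
    s (algebraMap ℝ E r) = algebraMap ℝ E r := by
  rw [Algebra.algebraMap_eq_smul_one, map_smul, h.map_one]

/-- Multiplying by `s x` on the left turns `x` into a positive scalar, which can be cancelled. -/
lemma eq_zero_of_mul_eq_zero (h : IsPositiveConjugation s) {x y : E} (hx : x ≠ 0)
    (hxy : x * y = 0) : y = 0 := by
  obtain ⟨r, hr, hr'⟩ := h.exists_pos x hx
  have : s x * x * y = 0 := by rw [mul_assoc, hxy, mul_zero]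
  rw [hr', ← Algebra.smul_def] at this
  exact (smul_eq_zero.1 this).resolve_left hr.ne'

lemma exists_add_skew (h : IsPositiveConjugation s) (x : E) :
    ∃ (r : ℝ) (y : E), s y = -y ∧ x = algebraMap ℝ E r + y := by
  obtain ⟨r, hr⟩ := h.exists_real ((1 / 2 : ℝ) • (x + s x)) (by
    rw [map_smul, map_add, h.involutive, add_comm])
  refine ⟨r, (1 / 2 : ℝ) • (x - s x), ?_, ?_⟩
  · rw [map_smul, map_sub, h.involutive, ← smul_neg, neg_sub]
  · rw [← hr]
    module

/-- The anticommutator of skew elements is a real scalar. -/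
lemma exists_anticomm (h : IsPositiveConjugation s) {x y : E} (hx : s x = -x) (hy : s y = -y) :
    ∃ r : ℝ, x * y + y * x = algebraMap ℝ E r := by
  refine h.exists_real _ ?_
  rw [map_add, h.map_mul, h.map_mul, hx, hy, neg_mul_neg, neg_mul_neg, add_comm]

/-- For skew `x` the square is `-(s x * x)`, a negative scalar, so `x` may be divided by the root of
its modulus. -/
lemma exists_normalize (h : IsPositiveConjugation s) {x : E} (hx : s x = -x) (h0 : x ≠ 0) :
    ∃ c : ℝ, c ≠ 0 ∧ (c • x) * (c • x) = -1 := by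
  obtain ⟨r, hr, hr'⟩ := h.exists_pos x h0
  have hxx : x * x = -algebraMap ℝ E r := by rw [← hr', hx, neg_mul, neg_neg]
  refine ⟨(Real.sqrt r)⁻¹, inv_ne_zero (Real.sqrt_pos.2 hr).ne', ?_⟩
  rw [smul_mul_smul_comm, hxx, smul_neg, Algebra.algebraMap_eq_smul_one, smul_smul,
    ← mul_inv, Real.mul_self_sqrt hr.le, inv_mul_cancel₀ hr.ne', one_smul]

/-- Subtracting from `y` its component along a skew `i` with `i * i = -1`. -/
lemma anticomm_sub_component {i y : E} (hii : i * i = -1) {t : ℝ}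
    (ht : i * y + y * i = algebraMap ℝ E t) :
    i * (y + (t / 2) • i) + (y + (t / 2) • i) * i = 0 := by
  have : i * (y + (t / 2) • i) + (y + (t / 2) • i) * i =
      (i * y + y * i) + (t / 2) • (i * i) + (t / 2) • (i * i) := by
    simp only [mul_add, add_mul, mul_smul_comm, smul_mul_assoc]
    abel
  rw [this, ht, hii, Algebra.algebraMap_eq_smul_one]
  module

/-- A real algebra with a positive conjugation is isomorphic to `ℝ`, `ℂ` or `ℍ`. -/
theorem exists_algEquiv (h : IsPositiveConjugation s) :
    Nonempty (E ≃ₐ[ℝ] ℝ) ∨ Nonempty (E ≃ₐ[ℝ] ℂ) ∨ Nonempty (E ≃ₐ[ℝ] ℍ[ℝ]) := by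
  have := h.nontrivial
  -- The three cases are: no nonzero skew elements, skew elements forming the line through `i`, and
  -- a skew element off that line.
  by_cases h1 : ∀ x, s x = -x → x = 0
  · left
    refine ⟨(AlgEquiv.ofBijective (Algebra.ofId ℝ E)
      ⟨(algebraMap ℝ E).injective, fun x => ?_⟩).symm⟩
    obtain ⟨r, y, hy, rfl⟩ := h.exists_add_skew x
    exact ⟨r, by simp [h1 y hy, Algebra.ofId_apply]⟩
  push Not at h1
  obtain ⟨x, hx, hx0⟩ := h1
  obtain ⟨c, hc, hii⟩ := h.exists_normalize hx hx0
  set i := c • x with hi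
  have hsi : s i = -i := by rw [hi, map_smul, hx, smul_neg]
  clear_value i
  by_cases h2 : ∀ y, s y = -y → ∃ r : ℝ, y = r • i
  · right; left
    refine ⟨(AlgEquiv.ofBijective (Complex.liftAux i hii) ⟨(Complex.liftAux i hii).injective,
      fun x => ?_⟩).symm⟩
    obtain ⟨r, y, hy, rfl⟩ := h.exists_add_skew x
    obtain ⟨t, rfl⟩ := h2 y hy
    exact ⟨⟨r, t⟩, by simp [Complex.liftAux_apply]⟩
  push Not at h2
  obtain ⟨y, hy, hyi⟩ := h2
  right; right
  obtain ⟨t, ht⟩ := h.exists_anticomm hsi hy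
  have hy0 : y + (t / 2) • i ≠ 0 := fun h0 => hyi (-(t / 2)) (by
    rw [neg_smul]; exact eq_neg_of_add_eq_zero_left h0)
  have hsy : s (y + (t / 2) • i) = -(y + (t / 2) • i) := by
    rw [map_add, map_smul, hy, hsi, smul_neg, neg_add]
  have hiy := anticomm_sub_component hii ht
  obtain ⟨c', hc', hjj⟩ := h.exists_normalize hsy hy0
  set j := c' • (y + (t / 2) • i) with hj
  have hsj : s j = -j := by rw [hj, map_smul, hsy, smul_neg]
  have hij : i * j + j * i = 0 := by
    rw [hj, mul_smul_comm, smul_mul_assoc, ← smul_add, hiy, smul_zero]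
  clear_value j
  have hji : j * i = -(i * j) := eq_neg_of_add_eq_zero_right hij
  have hsk : s (i * j) = -(i * j) := by rw [h.map_mul, hsi, hsj, neg_mul_neg, hji]
  have hkk : (i * j) * (i * j) = -1 := by
    rw [mul_assoc, ← mul_assoc j, hji, neg_mul, mul_neg, ← mul_assoc, ← mul_assoc, hii, neg_mul,
      one_mul, neg_mul, neg_neg, hjj]
  let q : QuaternionAlgebra.Basis E (-1 : ℝ) 0 (-1) :=
    { i := i, j := j, k := i * j
      i_mul_i := by simp [hii]
      j_mul_j := by simp [hjj]
      i_mul_j := rfl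
      j_mul_i := by simp [hji] }
  let f : ℍ[ℝ] →ₐ[ℝ] E := q.liftHom
  refine ⟨(AlgEquiv.ofBijective f ⟨f.toRingHom.injective, fun x => ?_⟩).symm⟩
  obtain ⟨r, z, hz, rfl⟩ := h.exists_add_skew x
  obtain ⟨t₁, ht₁⟩ := h.exists_anticomm hsi hz
  obtain ⟨t₂, ht₂⟩ := h.exists_anticomm hsj hz
  obtain ⟨t₃, ht₃⟩ := h.exists_anticomm hsk hz
  have hik : i * (i * j) + (i * j) * i = 0 := by
    rw [mul_assoc, hji, mul_neg, add_neg_cancel]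
  have hjk : j * (i * j) + (i * j) * j = 0 := by
    rw [← mul_assoc, hji, neg_mul, neg_add_cancel]
  have e1 := anticomm_sub_component hii ht₁
  have e2 := anticomm_sub_component hjj ht₂
  have e3 := anticomm_sub_component hkk ht₃
  -- The component of `z` along `i` is `-(t₁ / 2)` since `i * i = -1`, and similarly for `j` and `i
  -- * j`; what remains anticommutes with all three.
  set z' := z + (t₁ / 2) • i + (t₂ / 2) • j + (t₃ / 2) • (i * j) with hz'
  have a1 : i * z' + z' * i = 0 := by
    calc i * z' + z' * i = (i * (z + (t₁ / 2) • i) + (z + (t₁ / 2) • i) * i) +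
          (t₂ / 2) • (i * j + j * i) + (t₃ / 2) • (i * (i * j) + (i * j) * i) := by
            simp only [hz', mul_add, add_mul, mul_smul_comm, smul_mul_assoc, smul_add]
            abel
      _ = 0 := by rw [e1, hij, hik, smul_zero, smul_zero, add_zero, add_zero]
  have a2 : j * z' + z' * j = 0 := by
    calc j * z' + z' * j = (j * (z + (t₂ / 2) • j) + (z + (t₂ / 2) • j) * j) +
          (t₁ / 2) • (i * j + j * i) + (t₃ / 2) • (j * (i * j) + (i * j) * j) := by
            simp only [hz', mul_add, add_mul, mul_smul_comm, smul_mul_assoc, smul_add]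
            abel
      _ = 0 := by rw [e2, hij, hjk, smul_zero, smul_zero, add_zero, add_zero]
  have a3 : (i * j) * z' + z' * (i * j) = 0 := by
    calc (i * j) * z' + z' * (i * j) =
          ((i * j) * (z + (t₃ / 2) • (i * j)) + (z + (t₃ / 2) • (i * j)) * (i * j)) +
          (t₁ / 2) • (i * (i * j) + (i * j) * i) + (t₂ / 2) • (j * (i * j) + (i * j) * j) := by
            simp only [hz', mul_add, add_mul, mul_smul_comm, smul_mul_assoc, smul_add]
            abel
      _ = 0 := by rw [e3, hik, hjk, smul_zero, smul_zero, add_zero, add_zero]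
  -- Anticommuting with `i` and with `j` implies commuting with `i * j`. As `z'` also anticommutes
  -- with `i * j`, their product vanishes, and so does `z'`.
  have hcomm : z' * (i * j) = (i * j) * z' := by
    rw [← mul_assoc, eq_neg_of_add_eq_zero_right a1, neg_mul, mul_assoc,
      eq_neg_of_add_eq_zero_right a2, mul_neg, neg_neg, mul_assoc]
  have hz0 : z' = 0 := by
    refine h.eq_zero_of_mul_eq_zero (x := i * j) (fun h0 => ?_) ?_
    · rw [h0, zero_mul] at hkk
      exact one_ne_zero (neg_eq_zero.1 hkk.symm)
    · rw [hcomm, ← two_smul ℝ] at a3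
      exact (smul_eq_zero.1 a3).resolve_left two_ne_zero
  refine ⟨quaternionOf r (-(t₁ / 2)) (-(t₂ / 2)) (-(t₃ / 2)), ?_⟩
  show algebraMap ℝ E r + (-(t₁ / 2)) • i + (-(t₂ / 2)) • j + (-(t₃ / 2)) • (i * j) = _
  rw [show z = z' - ((t₁ / 2) • i + (t₂ / 2) • j + (t₃ / 2) • (i * j)) by rw [hz']; abel, hz0]
  module

variable {D : Type} [DivisionRing D] [Algebra ℝ D] [StarRing D] [StarModule ℝ D]
  {re : D →ₗ[ℝ] ℝ} {d : ℕ} {u : Fin d → D} {c : ℕ} {z : Fin c → Subalgebra.center ℝ D}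

lemma _root_.CardyFrobenius.IsConjugationAlgebra.exists_real (hD : IsConjugationAlgebra re u z)
    {x : D} (hx : star x = x) : x = algebraMap ℝ D (re x) := by
  have := hD.star_add_self x
  rw [hx, two_mul, map_add, ← two_smul ℝ, ← two_smul ℝ (algebraMap ℝ D _)] at this
  exact smul_right_injective D (two_ne_zero (α := ℝ)) this

/-- An isomorphism with a standard division algebra respects the conjugations. -/
theorem map_conj (h : IsPositiveConjugation s) (hD : IsConjugationAlgebra re u z)
    (e : E ≃ₐ[ℝ] D) (x : E) : e (s x) = star (e x) := by
  have hreal : ∀ r : ℝ, star (algebraMap ℝ D r) = algebraMap ℝ D r := fun r => by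
    rw [Algebra.algebraMap_eq_smul_one, star_smul, star_one, star_trivial]
  obtain ⟨r, y, hy, rfl⟩ := h.exists_add_skew x
  suffices e (s y) = star (e y) by
    rw [map_add, map_add, h.map_algebraMap, map_add, star_add, AlgEquiv.commutes, hreal, this]
  by_cases hy0 : y = 0
  · simp [hy0]
  obtain ⟨a, ha, ha'⟩ := h.exists_pos y hy0
  rw [hy, neg_mul] at ha'
  have hyy : e y * e y = -algebraMap ℝ D a := by
    rw [← map_mul, ← neg_neg (y * y), ha', map_neg, AlgEquiv.commutes]
  have hst := hD.star_add_self (e y)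
  have hst' : star (e y) = algebraMap ℝ D (2 * re (e y)) - e y := eq_sub_of_add_eq hst
  have hN := hD.exists_real (x := star (e y) * e y) (by simp)
  rw [hst', sub_mul, hyy, sub_neg_eq_add, ← Algebra.smul_def] at hN
  -- The norm of `e y` is a real scalar and equals `2 re (e y) • e y + a`. If `re (e y) ≠ 0`, then
  -- `e y` is itself real, yet its square is `-a < 0`.
  by_cases ht : re (e y) = 0
  · rw [hst', ht, hy]
    simp
  · exfalso
    set b := re ((2 * re (e y)) • e y + algebraMap ℝ D a)
    have hyb : e y = algebraMap ℝ D ((2 * re (e y))⁻¹ * (b - a)) := by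
      rw [map_mul, ← Algebra.smul_def, map_sub, ← hN, add_sub_cancel_right, smul_smul,
        inv_mul_cancel₀ (mul_ne_zero two_ne_zero ht), one_smul]
    rw [hyb, ← map_mul, ← map_neg] at hyy
    have := (algebraMap ℝ D).injective hyy
    nlinarith [mul_self_nonneg ((2 * re (e y))⁻¹ * (b - a))]

end IsPositiveConjugation

end PositiveInvolution

/-! ### Hermitian forms and orthonormal bases over `D` -/

section HermitianModule

open scoped InnerProductSpace

variable {D : Type} [DivisionRing D] [Algebra ℝ D] [StarRing D] [StarModule ℝ D]
  {re : D →ₗ[ℝ] ℝ} {d : ℕ} {u : Fin d → D} {c : ℕ} {z : Fin c → Subalgebra.center ℝ D}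
  {V : Type v} [NormedAddCommGroup V] [InnerProductSpace ℝ V] [Module D V] [IsScalarTower ℝ D V]

/-- The `D`-valued Hermitian form with `Re (hermForm u v w * y) = ⟪v, y • w⟫`. -/
noncomputable def hermForm (u : Fin d → D) (v w : V) : D :=
  ∑ a, ⟪v, u a • w⟫_ℝ • star (u a)

omit [StarModule ℝ D] [IsScalarTower ℝ D V] in
lemma hermForm_add_right (v w w' : V) :
    hermForm u v (w + w') = hermForm u v w + hermForm u v w' := by
  simp [hermForm, inner_add_right, add_smul, Finset.sum_add_distrib]

omit [StarModule ℝ D] [IsScalarTower ℝ D V] in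
lemma hermForm_add_left (v v' w : V) :
    hermForm u (v + v') w = hermForm u v w + hermForm u v' w := by
  simp [hermForm, inner_add_left, add_smul, Finset.sum_add_distrib]

omit [StarModule ℝ D] [IsScalarTower ℝ D V] in
lemma hermForm_real_smul_left (r : ℝ) (v w : V) :
    hermForm u (r • v) w = r • hermForm u v w := by
  simp [hermForm, inner_smul_left, Finset.smul_sum, smul_smul]

namespace IsConjugationAlgebra

/-- This characterises the form: `re` is nondegenerate, so identities in `D` can be tested under `re
(· * y)`, where they become identities of the real inner product. -/
lemma re_hermForm_mul (hD : IsConjugationAlgebra re u z) (v w : V) (y : D) :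
    re (hermForm u v w * y) = ⟪v, y • w⟫_ℝ := by
  conv_rhs => rw [← hD.dual.swap hD.re_mul_comm y]
  simp only [hermForm, Finset.sum_mul, Finset.sum_smul, map_sum, inner_sum, smul_mul_assoc,
    map_smul, smul_assoc, inner_smul_right, smul_eq_mul]
  refine Finset.sum_congr rfl fun a _ => ?_
  rw [hD.re_mul_comm, mul_comm]

lemma hermForm_smul_right (hD : IsConjugationAlgebra re u z) (v w : V) (x : D) :
    hermForm u v (x • w) = x * hermForm u v w := by
  refine hD.dual.ext fun y => ?_
  rw [hD.re_hermForm_mul, smul_smul, mul_assoc, hD.re_mul_comm x, mul_assoc, hD.re_hermForm_mul]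

lemma hermForm_isometry (hD : IsConjugationAlgebra re u z) {T : V →ₗ[ℝ] V}
    (hT : ∀ v w, ⟪T v, T w⟫_ℝ = ⟪v, w⟫_ℝ) (hT' : ∀ (x : D) v, T (x • v) = x • T v) (v w : V) :
    hermForm u (T v) (T w) = hermForm u v w := by
  refine hD.dual.ext fun y => ?_
  rw [hD.re_hermForm_mul, hD.re_hermForm_mul, ← hT', hT]

lemma hermForm_sum_left (hD : IsConjugationAlgebra re u z) {n : ℕ} {v : Fin n → V}
    (hv : ∀ i j, hermForm u (v i) (v j) = if i = j then 1 else 0) (x : Fin n → D) (i : Fin n) :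
    hermForm u (v i) (∑ j, x j • v j) = x i := by
  have : hermForm u (v i) (∑ j, x j • v j) = ∑ j, hermForm u (v i) (x j • v j) :=
    map_sum (AddMonoidHom.mk' (hermForm u (v i)) (hermForm_add_right (v i))) _ _
  rw [this]
  simp [hD.hermForm_smul_right, hv]

variable (hV : ∀ (x : D) (v w : V), ⟪x • v, w⟫_ℝ = ⟪v, star x • w⟫_ℝ)

include hV

lemma star_hermForm (hD : IsConjugationAlgebra re u z) (v w : V) :
    star (hermForm u v w) = hermForm u w v := by
  refine hD.dual.ext fun y => ?_
  rw [← hD.re_star, star_mul, star_star, hD.re_mul_comm, hD.re_hermForm_mul, hD.re_hermForm_mul,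
    ← hV, real_inner_comm]

lemma hermForm_self (hD : IsConjugationAlgebra re u z) (v : V) :
    hermForm u v v = algebraMap ℝ D ⟪v, v⟫_ℝ := by
  have h1 := hD.re_hermForm_mul v v 1
  rw [mul_one, one_smul] at h1
  rw [← h1]
  exact hD.exists_real (hD.star_hermForm hV v v)

omit hV in
lemma linearIndependent_of_orthonormal (hD : IsConjugationAlgebra re u z) {n : ℕ} {v : Fin n → V}
    (hv : ∀ i j, hermForm u (v i) (v j) = if i = j then 1 else 0) : LinearIndependent D v := by
  rw [Fintype.linearIndependent_iff]
  intro x hx i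
  rw [← hD.hermForm_sum_left hv x i, hx]
  simp [hermForm]

/-- Gram–Schmidt over `D`: since `hermForm u w w` is the real scalar `‖w‖²`, a vector can be
normalised by a real factor. -/
lemma exists_orthonormal (hD : IsConjugationAlgebra re u z) [Module.Finite D V] :
    ∀ m ≤ Module.finrank D V, ∃ v : Fin m → V,
      ∀ i j, hermForm u (v i) (v j) = if i = j then 1 else 0 := by
  intro m
  induction m with
  | zero => exact fun _ => ⟨Fin.elim0, fun i => i.elim0⟩
  | succ m ih =>
    intro hm
    obtain ⟨v, hv⟩ := ih (by omega)
    have hspan : Submodule.span D (Set.range v) ≠ ⊤ := by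
      intro htop
      have h1 := finrank_range_le_card (R := D) v
      rw [Set.finrank, htop, finrank_top, Fintype.card_fin] at h1
      omega
    obtain ⟨w, -, hw⟩ := SetLike.exists_of_lt (lt_top_iff_ne_top.2 hspan)
    set w' := w - ∑ j, hermForm u (v j) w • v j with hw'
    have hw0 : w' ≠ 0 := by
      intro h0
      rw [sub_eq_zero.1 h0] at hw
      exact hw (Submodule.sum_mem _ fun j _ =>
        Submodule.smul_mem _ _ (Submodule.subset_span ⟨j, rfl⟩))
    have horth : ∀ i, hermForm u (v i) w' = 0 := by
      intro i
      have := hermForm_add_right (u := u) (v i) w' (∑ j, hermForm u (v j) w • v j)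
      rw [hD.hermForm_sum_left hv (fun j => hermForm u (v j) w), hw', sub_add_cancel] at this
      exact right_eq_add.1 this
    set w'' := (‖w'‖⁻¹ : ℝ) • w' with hw''
    have horth' : ∀ i, hermForm u (v i) w'' = 0 := by
      intro i
      rw [hw'', ← algebraMap_smul D, hD.hermForm_smul_right, horth, mul_zero]
    have hself : hermForm u w'' w'' = 1 := by
      rw [hD.hermForm_self hV, real_inner_self_eq_norm_sq, hw'', norm_smul, norm_inv, norm_norm,
        inv_mul_cancel₀ (norm_ne_zero_iff.2 hw0), one_pow, map_one]
    refine ⟨Fin.snoc v w'', fun i j => ?_⟩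
    induction i using Fin.lastCases with
    | last =>
      induction j using Fin.lastCases with
      | last => simp [hself]
      | cast j =>
        rw [Fin.snoc_last, Fin.snoc_castSucc, ← hD.star_hermForm hV, horth', star_zero,
          if_neg (Fin.castSucc_lt_last j).ne']
    | cast i =>
      induction j using Fin.lastCases with
      | last => rw [Fin.snoc_last, Fin.snoc_castSucc, horth', if_neg (Fin.castSucc_lt_last i).ne]
      | cast j => simp [hv]

omit hV [StarModule ℝ D] [IsScalarTower ℝ D V] in
/-- The matrix of a `D`-linear operator in an orthonormal basis of a left `D`-module. -/
noncomputable def _root_.CardyFrobenius.hermMatrix (u : Fin d → D) {n : ℕ} (v : Fin n → V) :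
    (V →ₗ[ℝ] V) →ₗ[ℝ] Matrix (Fin n) (Fin n) D where
  toFun T := Matrix.of fun i j => hermForm u (T (v j)) (v i)
  map_add' S T := by
    ext i j
    simp [hermForm_add_left]
  map_smul' r T := by
    ext i j
    simp [hermForm_real_smul_left]

omit hV [StarModule ℝ D] [IsScalarTower ℝ D V] in
lemma _root_.CardyFrobenius.hermMatrix_apply {n : ℕ} (v : Fin n → V) (T : V →ₗ[ℝ] V)
    (i j : Fin n) : hermMatrix u v T i j = hermForm u (T (v j)) (v i) := rfl

section Basis

variable [Module.Finite D V] {n : ℕ} {v : Fin n → V}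

omit hV in
lemma sum_hermForm_smul (hD : IsConjugationAlgebra re u z) (hn : Module.finrank D V = n)
    (hv : ∀ i j, hermForm u (v i) (v j) = if i = j then 1 else 0) (w : V) :
    ∑ i, hermForm u (v i) w • v i = w := by
  have hspan := (hD.linearIndependent_of_orthonormal hv).span_eq_top_of_card_eq_finrank'
    (by simp [hn])
  obtain ⟨x, rfl⟩ := (Submodule.mem_span_range_iff_exists_fun D).1
    (hspan ▸ Submodule.mem_top : w ∈ Submodule.span D (Set.range v))
  simp only [hD.hermForm_sum_left hv]

/-- For a left `D`-module the plain coefficient matrices would multiply the entries in the opposite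
order. Having `T (v j)` in the first slot conjugates the coefficients, which restores the order. -/
lemma hermMatrix_mul (hD : IsConjugationAlgebra re u z) (hn : Module.finrank D V = n)
    (hv : ∀ i j, hermForm u (v i) (v j) = if i = j then 1 else 0) {S T : V →ₗ[ℝ] V}
    (hS : ∀ (x : D) v, S (x • v) = x • S v) :
    hermMatrix u v (S * T) = hermMatrix u v S * hermMatrix u v T := by
  ext i j
  rw [Matrix.mul_apply]
  simp only [hermMatrix_apply, Module.End.mul_apply]
  conv_lhs => rw [← hD.sum_hermForm_smul hn hv (T (v j)), map_sum, ← hD.star_hermForm hV]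
  have hsum : ∀ f : Fin n → V, hermForm u (v i) (∑ k, f k) = ∑ k, hermForm u (v i) (f k) :=
    fun f => map_sum (AddMonoidHom.mk' (hermForm u (v i)) (hermForm_add_right (v i))) _ _
  simp only [hS, hsum, hD.hermForm_smul_right, star_sum, star_mul, hD.star_hermForm hV]

omit hV [Module.Finite D V] [StarModule ℝ D] [IsScalarTower ℝ D V] in
lemma hermMatrix_one (hv : ∀ i j, hermForm u (v i) (v j) = if i = j then 1 else 0) :
    hermMatrix u v (1 : V →ₗ[ℝ] V) = 1 := by
  ext i j
  simp [hermMatrix_apply, hv, Matrix.one_apply, eq_comm]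

lemma eq_zero_of_hermMatrix (hD : IsConjugationAlgebra re u z) (hn : Module.finrank D V = n)
    (hv : ∀ i j, hermForm u (v i) (v j) = if i = j then 1 else 0) {T : V →ₗ[ℝ] V}
    (hT : ∀ (x : D) v, T (x • v) = x • T v) (h0 : hermMatrix u v T = 0) : T = 0 := by
  have h1 : ∀ j, T (v j) = 0 := by
    intro j
    rw [← hD.sum_hermForm_smul hn hv (T (v j))]
    refine Finset.sum_eq_zero fun i _ => ?_
    rw [← hD.star_hermForm hV, ← hermMatrix_apply, h0, Matrix.zero_apply, star_zero, zero_smul]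
  ext w
  rw [← hD.sum_hermForm_smul hn hv w, map_sum]
  simp [hT, h1]

omit [Module.Finite D V] in
lemma exists_hermMatrix_eq (hD : IsConjugationAlgebra re u z)
    (hv : ∀ i j, hermForm u (v i) (v j) = if i = j then 1 else 0)
    (M : Matrix (Fin n) (Fin n) D) :
    ∃ T : V →ₗ[ℝ] V, (∀ (x : D) v, T (x • v) = x • T v) ∧ hermMatrix u v T = M := by
  -- The coefficients are conjugated because `hermMatrix` reads `T (v j)` through the
  -- conjugate-linear slot.
  refine ⟨{ toFun := fun w => ∑ j, hermForm u (v j) w • ∑ i, star (M i j) • v i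
            map_add' := fun w w' => by
              simp [hermForm_add_right, add_smul, Finset.sum_add_distrib]
            map_smul' := fun r w => by
              simp only [← algebraMap_smul D r, hD.hermForm_smul_right, mul_smul,
                Finset.smul_sum, RingHom.id_apply] }, fun x w => ?_, ?_⟩
  · simp only [LinearMap.coe_mk, AddHom.coe_mk, hD.hermForm_smul_right, mul_smul, Finset.smul_sum]
  · ext i j
    rw [hermMatrix_apply, ← hD.star_hermForm hV]
    simp only [LinearMap.coe_mk, AddHom.coe_mk, hv, ite_smul, one_smul, zero_smul,
      Finset.sum_ite_eq', Finset.mem_univ, if_true]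
    rw [hD.hermForm_sum_left hv, star_star]

end Basis

end IsConjugationAlgebra

end HermitianModule

/-! ### Irreducible real representations and their matrix forms -/

section Irreducible

variable {G : Type u} [Group G]

lemma nontrivial_of_isIrreducible {V : Type v} [AddCommGroup V] [Module ℝ V]
    (ρ : Representation ℝ G V) [ρ.IsIrreducible] : Nontrivial V := by
  by_contra h
  rw [not_nontrivial_iff_subsingleton] at h
  refine bot_ne_top (α := Subrepresentation ρ) (SetLike.ext fun v => ?_)
  rw [Subsingleton.elim v 0]
  exact ⟨fun _ => (⊤ : Subrepresentation ρ).toSubmodule.zero_mem,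
    fun _ => (⊥ : Subrepresentation ρ).toSubmodule.zero_mem⟩

noncomputable instance {V : Type v} [AddCommGroup V] [Module ℝ V] (ρ : Representation ℝ G V) :
    Ring (ρ.IntertwiningMap ρ) :=
  { (inferInstance : Semiring (ρ.IntertwiningMap ρ)),
    (inferInstance : AddCommGroup (ρ.IntertwiningMap ρ)) with }

section Isometric

open scoped InnerProductSpace

variable {V : Type v} [NormedAddCommGroup V] [InnerProductSpace ℝ V] [FiniteDimensional ℝ V]
  {ρ : Representation ℝ G V} (hρ : ∀ g v w, ⟪ρ g v, ρ g w⟫_ℝ = ⟪v, w⟫_ℝ)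

/-- The adjoint of an intertwining operator of an orthogonal representation. -/
noncomputable def intertwiningAdjoint : ρ.IntertwiningMap ρ →ₗ[ℝ] ρ.IntertwiningMap ρ where
  toFun f := ⟨LinearMap.adjoint f.toLinearMap, fun g => by
    ext v
    refine ext_inner_right ℝ fun w => ?_
    have hinv : ∀ w, ρ g (ρ g⁻¹ w) = w := fun w => by
      rw [← Module.End.mul_apply, ← map_mul, mul_inv_cancel, map_one, Module.End.one_apply]
    simp only [LinearMap.comp_apply]
    rw [LinearMap.adjoint_inner_left, ← hinv w, hρ, LinearMap.adjoint_inner_left]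
    simp only [Representation.IntertwiningMap.toLinearMap_apply]
    rw [Representation.IntertwiningMap.isIntertwining, hρ]⟩
  map_add' f g := Representation.IntertwiningMap.ext (by simp)
  map_smul' r f := Representation.IntertwiningMap.ext (by simp)

lemma intertwiningAdjoint_inner_left (f : ρ.IntertwiningMap ρ) (v w : V) :
    ⟪intertwiningAdjoint hρ f v, w⟫_ℝ = ⟪v, f w⟫_ℝ :=
  LinearMap.adjoint_inner_left f.toLinearMap w v

lemma intertwiningAdjoint_inner_right (f : ρ.IntertwiningMap ρ) (v w : V) :
    ⟪v, intertwiningAdjoint hρ f w⟫_ℝ = ⟪f v, w⟫_ℝ :=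
  LinearMap.adjoint_inner_right f.toLinearMap v w

/-- A symmetric intertwiner `f` has a real eigenvalue `r`; then `f - r` is not injective, hence zero
by Schur's lemma. In particular the adjoint of `f` times `f` is a scalar, positive because it scales
`‖v‖²` to `‖f v‖²`. -/
lemma isPositiveConjugation_adjoint [ρ.IsIrreducible] :
    IsPositiveConjugation (intertwiningAdjoint hρ) := by
  have hVn := nontrivial_of_isIrreducible ρ
  have hext : ∀ {f g : ρ.IntertwiningMap ρ}, (∀ v w, ⟪f v, w⟫_ℝ = ⟪g v, w⟫_ℝ) → f = g := by
    intro f g h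
    refine DFunLike.ext _ _ fun v => ext_inner_right ℝ fun w => h v w
  have hinvol : ∀ f, intertwiningAdjoint hρ (intertwiningAdjoint hρ f) = f := by
    intro f
    refine hext fun v w => ?_
    rw [intertwiningAdjoint_inner_left, intertwiningAdjoint_inner_right]
  have hmul : ∀ f g, intertwiningAdjoint hρ (f * g) =
      intertwiningAdjoint hρ g * intertwiningAdjoint hρ f := by
    intro f g
    refine hext fun v w => ?_
    simp only [Representation.IntertwiningMap.mul_apply, intertwiningAdjoint_inner_left]
  have hreal : ∀ f : ρ.IntertwiningMap ρ, intertwiningAdjoint hρ f = f →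
      ∃ r : ℝ, f = algebraMap ℝ _ r := by
    intro f hf
    have hsymm : f.toLinearMap.IsSymmetric := by
      intro v w
      simp only [Representation.IntertwiningMap.toLinearMap_apply]
      rw [← intertwiningAdjoint_inner_left hρ, hf]
    -- The supremum of the Rayleigh quotient is an eigenvalue; only its existence matters.
    have hev := hsymm.hasEigenvalue_iSup_of_finiteDimensional
    obtain ⟨v, hv⟩ := hev.exists_hasEigenvector
    generalize (⨆ x : { x : V // x ≠ 0 }, RCLike.re ⟪f.toLinearMap x, x⟫_ℝ / ‖(x : V)‖ ^ 2 : ℝ) = r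
      at hv
    refine ⟨r, sub_eq_zero.1 <| (Representation.IsIrreducible.injective_or_eq_zero
      (f - algebraMap ℝ _ r)).resolve_left fun hinj => hv.2 (hinj ?_)⟩
    rw [map_zero]
    simpa [sub_eq_zero] using hv.apply_eq_smul
  refine ⟨⟨hmul, hext fun v w => by simp [intertwiningAdjoint_inner_left], hinvol⟩, ?_, hreal, ?_⟩
  · obtain ⟨v, hv⟩ := exists_ne (0 : V)
    exact ⟨⟨0, 1, fun h => hv (congrArg (fun f : ρ.IntertwiningMap ρ => f v) h).symm⟩⟩
  · intro f hf
    obtain ⟨r, hr⟩ := hreal (intertwiningAdjoint hρ f * f) (by rw [hmul, hinvol])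
    refine ⟨r, ?_, hr⟩
    have : ∃ v, f v ≠ 0 := by
      by_contra! h
      exact hf (DFunLike.ext _ _ h)
    obtain ⟨v, hv⟩ := this
    have h1 : ⟪f v, f v⟫_ℝ = r * ⟪v, v⟫_ℝ := by
      rw [← intertwiningAdjoint_inner_left hρ, ← Representation.IntertwiningMap.mul_apply, hr]
      simp [inner_smul_left]
    by_contra! hr0
    have h2 : 0 < ⟪f v, f v⟫_ℝ := real_inner_self_pos.2 hv
    have h3 : 0 ≤ ⟪v, v⟫_ℝ := real_inner_self_nonneg
    nlinarith

end Isometric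

/-- A representation of `ℝ[G]` by matrices over `D` that respects the involutions, has the same
kernel as `ρ`, and every matrix of which comes from an operator that commutes with the
endomorphisms of `ρ`. -/
structure IsMatrixForm {V : Type v} [AddCommGroup V] [Module ℝ V] (ρ : Representation ℝ G V)
    {D : Type} [DivisionRing D] [Algebra ℝ D] [StarRing D] {n : ℕ}
    (Φ : MonoidAlgebra ℝ G →ₐ[ℝ] Matrix (Fin n) (Fin n) D) : Prop where
  map_antipode : ∀ x, Φ (antipode ℝ G x) = (Φ x).conjTranspose
  eq_zero : ∀ x, Φ x = 0 → ρ.asAlgebraHom x = 0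
  exists_operator : ∀ M, ∃ T : V →ₗ[ℝ] V, (∀ (f : ρ.IntertwiningMap ρ) v, T (f v) = f (T v)) ∧
    ∀ x, ρ.asAlgebraHom x = T → Φ x = M

variable {D : Type} [DivisionRing D] [Algebra ℝ D] [StarRing D] [StarModule ℝ D]
  {re : D →ₗ[ℝ] ℝ} {d : ℕ} {u : Fin d → D} {c : ℕ} {z : Fin c → Subalgebra.center ℝ D}

section

open scoped InnerProductSpace

/-- Through `e` the space `V` becomes a `D`-module on which conjugation is the adjoint, and `n` is
its `D`-dimension, so the division by `d` is exact. The group acts by `D`-linear isometries, hence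
by unitary matrices in an orthonormal `D`-basis. -/
lemma exists_matrixForm_of_isometric {V : Type v} [NormedAddCommGroup V] [InnerProductSpace ℝ V]
    [FiniteDimensional ℝ V] {ρ : Representation ℝ G V} [ρ.IsIrreducible]
    (hρ : ∀ g v w, ⟪ρ g v, ρ g w⟫_ℝ = ⟪v, w⟫_ℝ) (hD : IsConjugationAlgebra re u z)
    (e : ρ.IntertwiningMap ρ ≃ₐ[ℝ] D) :
    Module.finrank ℝ V / d * d = Module.finrank ℝ V ∧
    ∃ Φ : MonoidAlgebra ℝ G →ₐ[ℝ]
      Matrix (Fin (Module.finrank ℝ V / d)) (Fin (Module.finrank ℝ V / d)) D, IsMatrixForm ρ Φ := by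
  have hs := isPositiveConjugation_adjoint hρ
  let η : D →+* Module.End ℝ V :=
    { toFun := fun x => (e.symm x).toLinearMap
      map_one' := by rw [map_one]; rfl
      map_mul' := fun x y => by rw [map_mul]; rfl
      map_zero' := by rw [map_zero]; rfl
      map_add' := fun x y => by rw [map_add]; rfl }
  let _ : Module D V := Module.compHom V η
  have hsmul : ∀ (x : D) (v : V), x • v = e.symm x v := fun _ _ => rfl
  have : IsScalarTower ℝ D V := ⟨fun r x v => by
    rw [hsmul, hsmul, map_smul, Representation.IntertwiningMap.smul_apply]⟩
  have : Module.Finite D V := Module.Finite.of_restrictScalars_finite ℝ D V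
  have hV : ∀ (x : D) (v w : V), ⟪x • v, w⟫_ℝ = ⟪v, star x • w⟫_ℝ := by
    intro x v w
    have h1 := hs.map_conj hD e (e.symm x)
    rw [e.apply_symm_apply] at h1
    rw [hsmul, hsmul, ← h1, e.symm_apply_apply, intertwiningAdjoint_inner_right]
  have hrank : d * Module.finrank D V = Module.finrank ℝ V := by
    rw [← hD.finrank_eq]
    exact Module.finrank_mul_finrank ℝ D V
  have hd : d ≠ 0 := by exact_mod_cast hD.dim_ne_zero
  have hn : Module.finrank D V = Module.finrank ℝ V / d := by
    rw [← hrank, Nat.mul_div_cancel_left _ (Nat.pos_of_ne_zero hd)]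
  refine ⟨by rw [← hn, mul_comm, hrank], ?_⟩
  rw [← hn]
  obtain ⟨v, hv⟩ := hD.exists_orthonormal hV _ le_rfl
  have hlin : ∀ (y : MonoidAlgebra ℝ G) (x : D) (v : V),
      ρ.asAlgebraHom y (x • v) = x • ρ.asAlgebraHom y v := by
    intro y x v
    induction y using MonoidAlgebra.induction_linear with
    | zero => simp
    | add a b ha hb => rw [map_add, LinearMap.add_apply, LinearMap.add_apply, ha, hb, smul_add]
    | single g r =>
      rw [Representation.asAlgebraHom_single, LinearMap.smul_apply, LinearMap.smul_apply, hsmul,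
        hsmul, map_smul, Representation.IntertwiningMap.isIntertwining]
  let Φ : MonoidAlgebra ℝ G →ₐ[ℝ] Matrix (Fin _) (Fin _) D :=
    AlgHom.ofLinearMap (hermMatrix u v ∘ₗ ρ.asAlgebraHom.toLinearMap)
      (by simp [IsConjugationAlgebra.hermMatrix_one hv])
      (fun x y => by
        simp only [LinearMap.comp_apply, AlgHom.toLinearMap_apply, map_mul]
        exact hD.hermMatrix_mul hV rfl hv (hlin x))
  have hΦ : ∀ x, Φ x = hermMatrix u v (ρ.asAlgebraHom x) := fun _ => rfl
  refine ⟨Φ, fun x => ?_, fun x hx => hD.eq_zero_of_hermMatrix hV rfl hv (hlin x) hx, fun M => ?_⟩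
  · induction x using MonoidAlgebra.induction_linear with
    | zero => simp
    | add a b ha hb => rw [map_add, map_add, map_add, ha, hb, Matrix.conjTranspose_add]
    | single g r =>
      rw [antipode_single, hΦ, hΦ, Representation.asAlgebraHom_single,
        Representation.asAlgebraHom_single, map_smul, map_smul, Matrix.conjTranspose_smul,
        star_trivial]
      congr 1
      -- Applying the isometry `ρ g` to both slots moves `ρ g⁻¹` from the first slot to `ρ g` in the
      -- second.
      ext i j
      rw [Matrix.conjTranspose_apply, hermMatrix_apply, hermMatrix_apply, hD.star_hermForm hV,
        ← hD.hermForm_isometry (hρ g) (fun x v => by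
          simpa [Representation.asAlgebraHom_single] using hlin (MonoidAlgebra.single g 1) x v),
        ← Module.End.mul_apply, ← map_mul, mul_inv_cancel, map_one, Module.End.one_apply]
  · obtain ⟨T, hT, hM⟩ := hD.exists_hermMatrix_eq hV hv M
    -- An intertwiner `f` acts as the scalar `e f` of `D`, so the `D`-linear `T` commutes with it.
    refine ⟨T, fun f w => ?_, fun x hx => by rw [hΦ, hx, hM]⟩
    have := hT (e f) w
    rwa [hsmul, hsmul, e.symm_apply_apply] at this

end

section Average

variable [Fintype G] {V : Type v} [AddCommGroup V] [Module ℝ V] [Module.Finite ℝ V]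
  (ρ : Representation ℝ G V)

/-- Every finite-dimensional real representation of a finite group preserves an inner product. -/
lemma exists_invariant_core : ∃ core : InnerProductSpace.Core ℝ V,
    ∀ g v w, core.inner (ρ g v) (ρ g w) = core.inner v w := by
  let b := Module.finBasis ℝ V
  let B : V → V → ℝ := fun v w => ∑ g : G, ∑ i, b.repr (ρ g v) i * b.repr (ρ g w) i
  refine ⟨{ inner := B
            conj_inner_symm := ?_
            re_inner_nonneg := ?_
            add_left := ?_
            smul_left := ?_
            definite := ?_ }, ?_⟩
  · intro v w
    simp only [B, conj_trivial, mul_comm]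
  · intro v
    exact Finset.sum_nonneg fun g _ => Finset.sum_nonneg fun i _ => mul_self_nonneg _
  · intro v v' w
    simp [B, add_mul, Finset.sum_add_distrib]
  · intro v w r
    simp [B, Finset.mul_sum, mul_assoc]
  · intro v hv
    -- The summand of the identity element alone already detects `v`.
    have h1 := (Finset.sum_eq_zero_iff_of_nonneg fun g _ => Finset.sum_nonneg fun i _ =>
      mul_self_nonneg (b.repr (ρ g v) i)).1 hv 1 (Finset.mem_univ _)
    have h2 := (Finset.sum_eq_zero_iff_of_nonneg fun i _ =>
      mul_self_nonneg (b.repr (ρ 1 v) i)).1 h1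
    refine b.ext_elem fun i => ?_
    simpa using h2 i (Finset.mem_univ _)
  · intro g v w
    show B (ρ g v) (ρ g w) = B v w
    simp only [B, ← Module.End.mul_apply, ← map_mul]
    exact Fintype.sum_equiv (Equiv.mulRight g) _ _ fun h => rfl

theorem exists_matrixForm [ρ.IsIrreducible] (hD : IsConjugationAlgebra re u z)
    (e : ρ.IntertwiningMap ρ ≃ₐ[ℝ] D) :
    Module.finrank ℝ V / d * d = Module.finrank ℝ V ∧
    ∃ Φ : MonoidAlgebra ℝ G →ₐ[ℝ]
      Matrix (Fin (Module.finrank ℝ V / d)) (Fin (Module.finrank ℝ V / d)) D,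
        IsMatrixForm ρ Φ := by
  obtain ⟨core, hcore⟩ := exists_invariant_core ρ
  let _ : NormedAddCommGroup V := core.toNormedAddCommGroup
  let _ : InnerProductSpace ℝ V := InnerProductSpace.ofCore core.toCore
  exact exists_matrixForm_of_isometric hcore hD e

/-- The endomorphism algebra of an irreducible real representation is `ℝ`, `ℂ` or `ℍ`. -/
theorem exists_type [ρ.IsIrreducible] : Nonempty (ρ.IntertwiningMap ρ ≃ₐ[ℝ] ℝ) ∨
    Nonempty (ρ.IntertwiningMap ρ ≃ₐ[ℝ] ℂ) ∨ Nonempty (ρ.IntertwiningMap ρ ≃ₐ[ℝ] ℍ[ℝ]) := by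
  obtain ⟨core, hcore⟩ := exists_invariant_core ρ
  let _ : NormedAddCommGroup V := core.toNormedAddCommGroup
  let _ : InnerProductSpace ℝ V := InnerProductSpace.ofCore core.toCore
  exact (isPositiveConjugation_adjoint (ρ := ρ) hcore).exists_algEquiv

end Average

end Irreducible

/-! ### Density and semisimplicity -/

section Density

/-- The density theorem for a finite family of pairwise non-isomorphic simple modules. -/
lemma exists_smul_eq_of_simple {R : Type u} [Ring R] [IsSemisimpleRing R] {ι : Type w} [Fintype ι]
    {M : ι → Type v} [∀ i, AddCommGroup (M i)] [∀ i, Module R (M i)]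
    [∀ i, IsSimpleModule R (M i)] (hM : ∀ i j, i ≠ j → IsEmpty (M i ≃ₗ[R] M j))
    (T : ∀ i, M i →+ M i) (hT : ∀ i (f : M i →ₗ[R] M i) m, T i (f m) = f (T i m))
    (s : ∀ i, Finset (M i)) : ∃ r : R, ∀ i, ∀ m ∈ s i, r • m = T i m := by
  classical
  -- By Schur's lemma there are no nonzero maps between different members, so commuting with each
  -- endomorphism ring is enough.
  have hcross : ∀ i j (f : M i →ₗ[R] M j) m, T j (f m) = f (T i m) := by
    intro i j f m
    obtain rfl | hij := eq_or_ne i j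
    · exact hT i f m
    · obtain hb | rfl := LinearMap.bijective_or_eq_zero f
      · exact ((hM i j hij).false (LinearEquiv.ofBijective f hb)).elim
      · simp
  -- The tuple of the `T i` commutes with every endomorphism of the product, as Jacobson density
  -- requires.
  let F : Module.End (Module.End R (∀ i, M i)) (∀ i, M i) :=
    { toFun := fun m i => T i (m i)
      map_add' := fun m m' => funext fun i => map_add (T i) _ _
      map_smul' := fun h m => by
        funext i
        simp only [RingHom.id_apply, Module.End.smul_def]
        have hdec : ∀ m : ∀ i, M i, h m i = ∑ j, h (Pi.single j (m j)) i := by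
          intro m
          conv_lhs => rw [← Finset.univ_sum_single m, map_sum, Finset.sum_apply]
        rw [hdec m, hdec, map_sum]
        refine Finset.sum_congr rfl fun j _ => ?_
        exact hcross j i (LinearMap.proj i ∘ₗ h ∘ₗ LinearMap.single R M j) (m j) }
  obtain ⟨r, hr⟩ := jacobson_density F
    (Finset.univ.biUnion fun i => (s i).image fun m => Pi.single i m)
  refine ⟨r, fun i m hm => ?_⟩
  have := congrFun (hr (Pi.single i m) (Finset.mem_biUnion.2
    ⟨i, Finset.mem_univ _, Finset.mem_image_of_mem _ hm⟩)) i
  simpa [F] using this.symm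

variable {G : Type u} [Group G]

noncomputable instance {V : Type v} [AddCommGroup V] [Module ℝ V] (ρ : Representation ℝ G V) :
    AddCommGroup ρ.asModule :=
  inferInstanceAs (AddCommGroup V)

/-- Density is applied to real bases of the finitely many spaces, where agreement already means
equality of operators. The group algebra is semisimple by Maschke's theorem. -/
lemma exists_asAlgebraHom_eq [Fintype G] {ι : Type w} [Fintype ι] {V : ι → Type v}
    [∀ i, AddCommGroup (V i)] [∀ i, Module ℝ (V i)] [∀ i, Module.Finite ℝ (V i)]
    (ρ : ∀ i, Representation ℝ G (V i)) [∀ i, (ρ i).IsIrreducible]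
    (hρ : ∀ i j, i ≠ j → IsEmpty ((ρ i).Equiv (ρ j)))
    (T : ∀ i, V i →ₗ[ℝ] V i) (hT : ∀ i (f : (ρ i).IntertwiningMap (ρ i)) v, T i (f v) = f (T i v)) :
    ∃ y : MonoidAlgebra ℝ G, ∀ i, (ρ i).asAlgebraHom y = T i := by
  classical
  have hcard : NeZero (Nat.card G : ℝ) := ⟨by exact_mod_cast Nat.card_pos.ne'⟩
  have hne : ∀ i j, i ≠ j → IsEmpty ((ρ i).asModule ≃ₗ[MonoidAlgebra ℝ G] (ρ j).asModule) := by
    refine fun i j hij => ⟨fun e => (hρ i j hij).false ?_⟩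
    exact Representation.IntertwiningMap.ofBijective
      ((Representation.IntertwiningMap.equivLinearMapAsModule (ρ i) (ρ j)).symm e.toLinearMap)
      e.bijective
  obtain ⟨y, hy⟩ := exists_smul_eq_of_simple (R := MonoidAlgebra ℝ G)
    (M := fun i => (ρ i).asModule) hne (fun i => (T i).toAddMonoidHom)
    (fun i f m => hT i ((Representation.IntertwiningMap.equivLinearMapAsModule _ _).symm f) m)
    (fun i => Finset.univ.image fun k =>
      (ρ i).asModuleEquiv.symm (Module.finBasis ℝ (V i) k))
  refine ⟨y, fun i => (Module.finBasis ℝ (V i)).ext fun k => ?_⟩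
  exact hy i _ (Finset.mem_image_of_mem _ (Finset.mem_univ k))

/-- An element of the group algebra that vanishes in every irreducible representation is zero. -/
lemma eq_zero_of_asAlgebraHom [Fintype G] {y : MonoidAlgebra ℝ G}
    (hy : ∀ π : RealIrrep G, π.ρ.asAlgebraHom y = 0) : y = 0 := by
  have hcard : NeZero (Nat.card G : ℝ) := ⟨by exact_mod_cast Nat.card_pos.ne'⟩
  have := (isDualFamily_group ℝ G).finite
  -- A simple left ideal, written in real coordinates, is an irreducible representation, so `y`
  -- annihilates it. By semisimplicity such ideals span the group algebra, whence `y * 1 = 0`.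
  have hsimple : ∀ S : Submodule (MonoidAlgebra ℝ G) (MonoidAlgebra ℝ G),
      IsSimpleModule (MonoidAlgebra ℝ G) S → ∀ x ∈ S, y * x = 0 := by
    intro S hS x hx
    have hfin : Module.Finite ℝ S :=
      inferInstanceAs (Module.Finite ℝ (S.restrictScalars ℝ))
    let b := Module.finBasis ℝ S
    let ρ : Representation ℝ G (Fin (Module.finrank ℝ S) → ℝ) :=
      (b.equivFun.conjAlgEquiv ℝ).toAlgHom.toRingHom.toMonoidHom.comp
        ((Algebra.lsmul ℝ ℝ S).toRingHom.toMonoidHom.comp (MonoidAlgebra.of ℝ G))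
    have hρ : ∀ (r : MonoidAlgebra ℝ G) (s : S),
        ρ.asAlgebraHom r (b.equivFun s) = b.equivFun (r • s) := by
      intro r s
      induction r using MonoidAlgebra.induction_linear with
      | zero => simp
      | add r r' h h' => rw [map_add, LinearMap.add_apply, h, h', add_smul, map_add]
      | single g r =>
        have h1 : ρ g (b.equivFun s) = b.equivFun (MonoidAlgebra.single g (1 : ℝ) • s) := by
          simp [ρ]
        rw [Representation.asAlgebraHom_single, LinearMap.smul_apply, h1, ← map_smul,
          ← smul_assoc, MonoidAlgebra.smul_single, smul_eq_mul, mul_one]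
    let e : S ≃ₗ[MonoidAlgebra ℝ G] ρ.asModule :=
      { b.equivFun.toAddEquiv with map_smul' := fun r s => (hρ r s).symm }
    have hirr : ρ.IsIrreducible := by
      rw [Representation.irreducible_iff_isSimpleModule_asModule]
      exact IsSimpleModule.congr e.symm
    have h0 := hρ y ⟨x, hx⟩
    rw [hy ⟨_, ρ, hirr⟩, LinearMap.zero_apply] at h0
    have h1 := b.equivFun.injective (h0.symm.trans (map_zero b.equivFun).symm)
    exact congrArg Subtype.val h1
  have htop : ∀ x : MonoidAlgebra ℝ G, y * x = 0 := by
    intro x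
    have hx : x ∈ sSup {S : Submodule (MonoidAlgebra ℝ G) (MonoidAlgebra ℝ G) |
        IsSimpleModule (MonoidAlgebra ℝ G) S} := by
      rw [IsSemisimpleModule.sSup_simples_eq_top]
      exact Submodule.mem_top
    rw [sSup_eq_iSup'] at hx
    induction hx using Submodule.iSup_induction' with
    | mem S x hx => exact hsimple S.1 S.2 x hx
    | zero => exact mul_zero y
    | add a b _ _ ha hb => rw [mul_add, ha, hb, add_zero]
  simpa using htop 1

end Density

/-! ### The blocks of the real group algebra -/

section Blocks

variable {G : Type u} [Group G]

lemma RealIrrep.dim_pos (π : RealIrrep G) : 0 < π.dim := by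
  have := π.irreducible
  have := nontrivial_of_isIrreducible π.ρ
  by_contra h
  have h0 : π.dim = 0 := by omega
  have : IsEmpty (Fin π.dim) := by rw [h0]; infer_instance
  exact not_subsingleton (Fin π.dim → ℝ) inferInstance

lemma RealIrrep.finrank_eq_dim {π : RealIrrep G} {D : DivType} (h : π.HasType D) :
    Module.finrank ℝ (π.ρ.IntertwiningMap π.ρ) = D.dim := by
  cases D with
  | real => exact h.some.toLinearEquiv.finrank_eq.trans isConjugationAlgebra_real.finrank_eq
  | complex => exact h.some.toLinearEquiv.finrank_eq.trans isConjugationAlgebra_complex.finrank_eq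
  | quaternionic =>
    exact h.some.toLinearEquiv.finrank_eq.trans isConjugationAlgebra_quaternion.finrank_eq

lemma finrank_intertwiningMap_congr {V W : Type*} [AddCommGroup V] [Module ℝ V] [AddCommGroup W]
    [Module ℝ W] {ρ : Representation ℝ G V} {σ : Representation ℝ G W} (e : ρ.Equiv σ) :
    Module.finrank ℝ (ρ.IntertwiningMap ρ) = Module.finrank ℝ (σ.IntertwiningMap σ) := by
  refine LinearEquiv.finrank_eq
    { toFun := fun f => (e.toIntertwiningMap.comp f).comp e.symm.toIntertwiningMap
      invFun := fun f => (e.symm.toIntertwiningMap.comp f).comp e.toIntertwiningMap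
      map_add' := fun f g => ?_
      map_smul' := fun r f => ?_
      left_inv := fun f => ?_
      right_inv := fun f => ?_ }
  all_goals
    refine DFunLike.ext _ _ fun v => ?_
    simp

lemma DivType.dim_injective : Function.Injective DivType.dim := by
  intro D D' h
  cases D <;> cases D' <;> first | rfl | exact absurd h (by decide)

/-- The type is read off from the dimension `1`, `2` or `4` of the endomorphism algebra, an
isomorphism invariant. -/
lemma RealIrrep.type_unique {π σ : RealIrrep G} {D D' : DivType} (hπ : π.HasType D)
    (hσ : σ.HasType D') (e : π.ρ.Equiv σ.ρ) : D = D' :=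
  DivType.dim_injective <| by
    rw [← π.finrank_eq_dim hπ, ← σ.finrank_eq_dim hσ, finrank_intertwiningMap_congr e]

variable [Fintype G]

lemma RealIrrep.exists_hasType (π : RealIrrep G) : ∃ D, π.HasType D := by
  have := π.irreducible
  obtain h | h | h := exists_type π.ρ
  · exact ⟨.real, h⟩
  · exact ⟨.complex, h⟩
  · exact ⟨.quaternionic, h⟩

/-- `Φ` exhibits the equipped algebra `H` as the block of `ℝ[G]` that belongs to the irreducible
representation `ρ`. -/
structure IsBlock {V : Type v} [AddCommGroup V] [Module ℝ V] (ρ : Representation ℝ G V)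
    (H : EquippedData.{0} ℝ) (Φ : MonoidAlgebra ℝ G →ₐ[ℝ] H.B) : Prop where
  equipped : H.IsEquippedCardyFrobenius
  φ_injective : Function.Injective H.φ
  trace : ∀ M : H.B, LinearMap.trace ℝ H.B (LinearMap.mulLeft ℝ M) = Fintype.card G * H.lB M
  map_antipode : ∀ x, Φ (antipode ℝ G x) = H.starB (Φ x)
  eq_zero : ∀ x, Φ x = 0 → ρ.asAlgebraHom x = 0
  exists_operator : ∀ M, ∃ T : V →ₗ[ℝ] V, (∀ (f : ρ.IntertwiningMap ρ) v, T (f v) = f (T v)) ∧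
    ∀ x, ρ.asAlgebraHom x = T → Φ x = M

section

variable {D : Type} [DivisionRing D] [Algebra ℝ D] [StarRing D] [StarModule ℝ D]
  {re : D →ₗ[ℝ] ℝ} {d : ℕ} {u : Fin d → D} {c : ℕ} {z : Fin c → Subalgebra.center ℝ D}

/-- The value of `μ` is chosen so that `n d / μ = dim π / (dim π / |G|) = |G|`, which is the trace
condition. -/
lemma exists_isBlock_matrixDataOf (hD : IsConjugationAlgebra re u z) (π : RealIrrep G)
    (e : π.ρ.IntertwiningMap π.ρ ≃ₐ[ℝ] D) :
    ∃ Φ, IsBlock π.ρ (matrixDataOf D re (π.dim / d) ((π.dim : ℝ) / (Fintype.card G : ℝ))) Φ := by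
  have := π.irreducible
  obtain ⟨hdim, hΦ⟩ := exists_matrixForm π.ρ hD e
  rw [Module.finrank_fin_fun] at hdim hΦ
  obtain ⟨Φ, hΦ⟩ := hΦ
  have hcard : (Fintype.card G : ℝ) ≠ 0 := by exact_mod_cast Fintype.card_ne_zero
  have hpos : (π.dim : ℝ) ≠ 0 := by exact_mod_cast π.dim_pos.ne'
  have hμ : (π.dim : ℝ) / (Fintype.card G : ℝ) ≠ 0 := div_ne_zero hpos hcard
  have hn : π.dim / d ≠ 0 := by
    intro h0
    rw [h0, zero_mul] at hdim
    exact π.dim_pos.ne hdim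
  refine ⟨Φ, hD.isEquipped hμ, IsConjugationAlgebra.φ_injective hn, fun M => ?_,
    hΦ.map_antipode, hΦ.eq_zero, hΦ.exists_operator⟩
  refine (hD.trace_mulLeft hμ M).trans ?_
  congr 1
  rw [← Nat.cast_mul, hdim]
  field_simp

end

lemma exists_isBlock_summand (x : Σ D : DivType, Ir G D) : ∃ π : RealIrrep G,
    Quotient.mk (RealIrrep.setoid G) π = x.2.1 ∧ π.HasType x.1 ∧
      ∃ Φ, IsBlock π.ρ (summand G x) Φ := by
  obtain ⟨D, c, π, rfl, hπ⟩ := x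
  refine ⟨π, rfl, hπ, ?_⟩
  cases D with
  | real => exact exists_isBlock_matrixDataOf isConjugationAlgebra_real π hπ.some
  | complex => exact exists_isBlock_matrixDataOf isConjugationAlgebra_complex π hπ.some
  | quaternionic => exact exists_isBlock_matrixDataOf isConjugationAlgebra_quaternion π hπ.some

/-- A representation in the class `x`, of the type of `x`. -/
noncomputable def blockRep (x : Σ D : DivType, Ir G D) : RealIrrep G :=
  (exists_isBlock_summand x).choose

lemma mk_blockRep (x : Σ D : DivType, Ir G D) :
    Quotient.mk (RealIrrep.setoid G) (blockRep x) = x.2.1 :=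
  (exists_isBlock_summand x).choose_spec.1

lemma hasType_blockRep (x : Σ D : DivType, Ir G D) : (blockRep x).HasType x.1 :=
  (exists_isBlock_summand x).choose_spec.2.1

/-- The projection of the real group algebra onto the block of `x`. -/
noncomputable def blockHom (x : Σ D : DivType, Ir G D) :
    MonoidAlgebra ℝ G →ₐ[ℝ] (summand G x).B :=
  (exists_isBlock_summand x).choose_spec.2.2.choose

lemma isBlock_blockHom (x : Σ D : DivType, Ir G D) :
    IsBlock (blockRep x).ρ (summand G x) (blockHom x) :=
  (exists_isBlock_summand x).choose_spec.2.2.choose_spec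

lemma isEmpty_equiv_blockRep (x y : Σ D : DivType, Ir G D) (hxy : x ≠ y) :
    IsEmpty ((blockRep x).ρ.Equiv (blockRep y).ρ) := by
  refine ⟨fun e => hxy ?_⟩
  have h1 := RealIrrep.type_unique (hasType_blockRep x) (hasType_blockRep y) e
  have h2 : x.2.1 = y.2.1 := by
    rw [← mk_blockRep, ← mk_blockRep]
    exact Quotient.sound (s := RealIrrep.setoid G) ⟨e⟩
  obtain ⟨D, c⟩ := x
  obtain ⟨D', c'⟩ := y
  obtain rfl : D = D' := h1
  exact congrArg _ (Subtype.ext h2)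

lemma exists_equiv_blockRep (π : RealIrrep G) :
    ∃ x : Σ D : DivType, Ir G D, Nonempty (π.ρ.Equiv (blockRep x).ρ) := by
  obtain ⟨D, hD⟩ := π.exists_hasType
  let x : Σ D : DivType, Ir G D := ⟨D, Quotient.mk _ π, π, rfl, hD⟩
  exact ⟨x, Quotient.exact (s := RealIrrep.setoid G) (mk_blockRep x).symm⟩

variable (G) in
-- By density the group algebra can act by arbitrary scalars on any finite family of non-isomorphic
-- irreducibles. A family of `|G| + 1` of them would give a surjection from a space of dimension
-- `|G|` onto one of dimension `|G| + 1`.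
theorem finite_irreps : Finite (Σ D : DivType, Ir G D) := by
  by_contra hinf
  rw [not_finite_iff_infinite] at hinf
  obtain ⟨s, hs⟩ := Infinite.exists_subset_card_eq (Σ D : DivType, Ir G D) (Fintype.card G + 1)
  have := fun x : s => (blockRep x.1).irreducible
  let L : MonoidAlgebra ℝ G →ₗ[ℝ] (s → ℝ) := LinearMap.pi fun x =>
    LinearMap.proj ⟨0, (blockRep x.1).dim_pos⟩ ∘ₗ
      LinearMap.applyₗ (Pi.single ⟨0, (blockRep x.1).dim_pos⟩ 1) ∘ₗ
        (blockRep x.1).ρ.asAlgebraHom.toLinearMap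
  have hL : Function.Surjective L := by
    intro t
    obtain ⟨y, hy⟩ := exists_asAlgebraHom_eq (fun x : s => (blockRep x.1).ρ)
      (fun x y hxy => isEmpty_equiv_blockRep x.1 y.1 fun h => hxy (Subtype.ext h))
      (fun x => t x • LinearMap.id) (fun x f v => by simp)
    refine ⟨y, funext fun x => ?_⟩
    simp [L, hy]
  have := (isDualFamily_group ℝ G).finite
  have h1 := LinearMap.finrank_le_finrank_of_surjective hL
  rw [Module.finrank_fintype_fun_eq_card, Fintype.card_coe, hs] at h1
  have h2 : Module.finrank ℝ (MonoidAlgebra ℝ G) = Fintype.card G :=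
    (MonoidAlgebra.coeffLinearEquiv ℝ).finrank_eq.trans (Module.finrank_finsupp_self ℝ)
  omega

variable [Fintype (Σ D : DivType, Ir G D)]

/-- An element killed by all blocks acts as zero in every irreducible representation. Conversely,
density realises any tuple of matrices, since each matrix comes from an operator commuting with the
intertwiners. -/
lemma blockHom_bijective : Function.Bijective
    (AlgHom.pi fun x : Σ D : DivType, Ir G D => (blockHom x : MonoidAlgebra ℝ G →ₐ[ℝ] _)) := by
  constructor
  · refine (injective_iff_map_eq_zero _).2 fun y hy => eq_zero_of_asAlgebraHom fun π => ?_
    obtain ⟨x, ⟨e⟩⟩ := exists_equiv_blockRep π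
    have h0 := (isBlock_blockHom x).eq_zero y (congrFun hy x)
    have hconj : ∀ r v, e (π.ρ.asAlgebraHom r v) = (blockRep x).ρ.asAlgebraHom r (e v) := by
      intro r v
      induction r using MonoidAlgebra.induction_linear with
      | zero => simp
      | add a b ha hb => rw [map_add, map_add, LinearMap.add_apply, map_add, ha, hb]; rfl
      | single g r =>
        have := Representation.IntertwiningMap.isIntertwining _ _ e.toIntertwiningMap g v
        simp only [Representation.Equiv.coe_toIntertwiningMap] at this
        simp [this]
    refine LinearMap.ext fun v => ?_
    refine e.injective ((hconj y v).trans ?_)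
    rw [h0]
    exact (map_zero e).symm
  · intro M
    have := fun x => (blockRep (G := G) x).irreducible
    choose T hT hM using fun x => (isBlock_blockHom (G := G) x).exists_operator (M x)
    obtain ⟨y, hy⟩ := exists_asAlgebraHom_eq (fun x => (blockRep (G := G) x).ρ)
      isEmpty_equiv_blockRep T hT
    exact ⟨y, funext fun x => hM x y (hy x)⟩

end Blocks

/-! ### The form as a multiple of the regular trace -/

lemma IsDualFamily.trace_mulLeft_iff {K : Type w} [Field K] {R : Type u} [Ring R] [Algebra K R]
    {l : R →ₗ[K] K} {ι : Type*} [Fintype ι] {e f : ι → R} (h : IsDualFamily l e f)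
    (hs : ∀ x y, l (x * y) = l (y * x)) (c : K) :
    (∀ x, LinearMap.trace K R (LinearMap.mulLeft K x) = c * l x) ↔
      ∑ i, f i * e i = algebraMap K R c := by
  have key : ∀ x, LinearMap.trace K R (LinearMap.mulLeft K x) = l (x * ∑ i, f i * e i) := by
    intro x
    rw [h.trace_eq]
    simp [Finset.mul_sum, mul_assoc]
  have hc : ∀ x, l (x * algebraMap K R c) = c * l x := by
    intro x
    rw [Algebra.algebraMap_eq_smul_one, mul_smul_comm, mul_one, map_smul, smul_eq_mul]
  constructor
  · intro ht
    refine h.ext fun z => ?_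
    rw [hs _ z, hs _ z, ← key, ht, hc]
  · intro ht x
    rw [key, ht, hc]

namespace EquippedData

/-- Restated as `∑ f i * e i = c`, the trace condition is visibly componentwise. -/
lemma trace_mulLeft_directSum {K : Type w} [Field K] {ι : Type v} [Fintype ι]
    {H : ι → EquippedData.{u} K} (h : ∀ i, (H i).IsEquippedCardyFrobenius) {c : K}
    (hc : ∀ i M, LinearMap.trace K (H i).B (LinearMap.mulLeft K M) = c * (H i).lB M)
    (M : (directSum H).B) :
    LinearMap.trace K (directSum H).B (LinearMap.mulLeft K M) = c * (directSum H).lB M := by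
  classical
  have hB := fun i => (h i).frobeniusB.exists_isDualFamily
  choose n e f hB using hB
  have hs := (IsEquippedCardyFrobenius.directSum h).frobeniusB.symm
  refine (IsDualFamily.trace_mulLeft_iff (l := (directSum H).lB) (IsDualFamily.pi hB) hs c).2 ?_ M
  have h1 := sum_single_mul_mul_single (R := fun i => (H i).B) f e 1
  simp only [mul_one, Pi.one_apply] at h1
  refine h1.trans (funext fun i => ?_)
  exact ((hB i).trace_mulLeft_iff (h i).frobeniusB.symm c).1 (hc i)

end EquippedData

/-! ### The real and complex isomorphisms -/

section Real

variable {G : Type u} [Group G] [Fintype G]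

lemma trace_mulLeft_group (K : Type w) [Field K] (x : MonoidAlgebra K G) :
    LinearMap.trace K _ (LinearMap.mulLeft K x) = Fintype.card G * evalOne K G x := by
  refine ((isDualFamily_group K G).trace_mulLeft_iff (evalOne_mul_comm K G) _).2 ?_ x
  simp [MonoidAlgebra.single_mul_single, MonoidAlgebra.natCast_def]

variable [Fintype (Σ D : DivType, Ir G D)]

/-- The decomposition of the real group algebra into its blocks. -/
noncomputable def blockEquiv : MonoidAlgebra ℝ G ≃ₐ[ℝ] (EquippedData.directSum (summand G)).B :=
  AlgEquiv.ofBijective _ blockHom_bijective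

/-- Both forms are `|G|⁻¹` times the trace of left multiplication, which any algebra isomorphism
preserves. -/
lemma lB_blockEquiv (x : MonoidAlgebra ℝ G) :
    (EquippedData.directSum (summand G)).lB (blockEquiv x) = evalOne ℝ G x := by
  have hcard : (Fintype.card G : ℝ) ≠ 0 := by exact_mod_cast Fintype.card_ne_zero
  have h1 := EquippedData.trace_mulLeft_directSum (fun x => (isBlock_blockHom (G := G) x).equipped)
    (fun x => (isBlock_blockHom (G := G) x).trace) (blockEquiv x)
  refine mul_left_cancel₀ hcard (h1.symm.trans ?_)
  rw [← trace_mulLeft_group, ← LinearMap.trace_conj' _ (blockEquiv (G := G)).toLinearEquiv]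
  congr 1
  refine LinearMap.ext fun y => ?_
  simp [LinearEquiv.conj_apply]

lemma blockEquiv_antipode (x : MonoidAlgebra ℝ G) :
    blockEquiv (antipode ℝ G x) = (EquippedData.directSum (summand G)).starB (blockEquiv x) :=
  funext fun i => (isBlock_blockHom i).map_antipode x

lemma nonempty_iso_real : Nonempty (EquippedData.Iso (regular ℝ G)
    (EquippedData.directSum (summand G))) := by
  have hcard : (Fintype.card G : ℝ) ≠ 0 := by exact_mod_cast Fintype.card_ne_zero
  exact EquippedData.exists_iso_of_equivB (H := regular ℝ G)
    (regular_isStarCardyFrobenius ℝ G hcard)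
    (EquippedData.IsEquippedCardyFrobenius.directSum
      fun x => (isBlock_blockHom x).equipped).isStarCardyFrobenius
    (regular_φ_injective ℝ G)
    (EquippedData.directSum_φ_injective fun x => (isBlock_blockHom x).φ_injective)
    blockEquiv lB_blockEquiv blockEquiv_antipode

/-- The complexification of `blockEquiv`. -/
noncomputable def complexBlockHom : MonoidAlgebra ℂ G →ₐ[ℂ]
    (EquippedData.directSum fun x => (summand G x).complexify).B :=
  MonoidAlgebra.lift ℂ (∀ x, ℂ ⊗[ℝ] (summand G x).B) G
    { toFun := fun g x => 1 ⊗ₜ blockHom x (MonoidAlgebra.single g 1)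
      map_one' := funext fun x => by
        rw [← MonoidAlgebra.one_def, map_one, ← Algebra.TensorProduct.one_def, Pi.one_apply]
      map_mul' := fun g h => funext fun x => by
        rw [Pi.mul_apply, Algebra.TensorProduct.tmul_mul_tmul, one_mul, ← map_mul,
          MonoidAlgebra.single_mul_single, one_mul] }

lemma complexBlockHom_single (g : G) (r : ℂ) (x : Σ D : DivType, Ir G D) :
    complexBlockHom (MonoidAlgebra.single g r) x =
      r ⊗ₜ[ℝ] blockHom x (MonoidAlgebra.single g 1) := by
  refine (congrFun (MonoidAlgebra.lift_single _ g r) x).trans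
    ((TensorProduct.smul_tmul' r _ _).trans ?_)
  rw [smul_eq_mul, mul_one]

lemma lB_complexBlockHom (y : MonoidAlgebra ℂ G) :
    (EquippedData.directSum fun x => (summand G x).complexify).lB (complexBlockHom y) =
      evalOne ℂ G y := by
  induction y using MonoidAlgebra.induction_linear with
  | zero => rw [map_zero, map_zero, map_zero]
  | add a b ha hb => rw [map_add, map_add, map_add, ha, hb]
  | single g r =>
    classical
    have h1 := lB_blockEquiv (MonoidAlgebra.single g (1 : ℝ))
    rw [evalOne_single] at h1
    replace h1 := (EquippedData.sum_proj_apply (fun x => (summand G x).lB) _).symm.trans h1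
    refine (EquippedData.sum_proj_apply (fun x => (summand G x).complexify.lB) _).trans ?_
    have h2 : ∀ x, (summand G x).complexify.lB (complexBlockHom (MonoidAlgebra.single g r) x) =
        ((summand G x).lB (blockEquiv (MonoidAlgebra.single g (1 : ℝ)) x) : ℂ) * r := by
      intro x
      rw [complexBlockHom_single]
      exact EquippedData.baseChange_form_tmul _ _ _
    rw [evalOne_single, Finset.sum_congr rfl fun x _ => h2 x, ← Finset.sum_mul,
      ← Complex.ofReal_sum, h1]
    split_ifs <;> simp

lemma complexBlockHom_antipode (y : MonoidAlgebra ℂ G) :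
    complexBlockHom (antipode ℂ G y) =
      (EquippedData.directSum fun x => (summand G x).complexify).starB (complexBlockHom y) := by
  induction y using MonoidAlgebra.induction_linear with
  | zero => simp only [map_zero]
  | add a b ha hb => simp only [map_add, ha, hb]
  | single g r =>
    refine funext fun x => ?_
    rw [antipode_single, complexBlockHom_single, ← antipode_single,
      (isBlock_blockHom x).map_antipode]
    refine (LinearMap.baseChange_tmul _ _ _).symm.trans ?_
    exact congrArg (summand G x).complexify.starB (complexBlockHom_single g r x).symm

/-- A homomorphism that preserves a nondegenerate form is injective; surjectivity follows by
counting dimensions, which agree with those of the real decomposition. -/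
lemma complexBlockHom_bijective :
    Function.Bijective (complexBlockHom : MonoidAlgebra ℂ G →ₐ[ℂ] _) := by
  have hinj : Function.Injective (complexBlockHom : MonoidAlgebra ℂ G →ₐ[ℂ] _) := by
    refine (injective_iff_map_eq_zero _).2 fun y hy => (isDualFamily_group ℂ G).eq_zero fun z => ?_
    rw [← lB_complexBlockHom, map_mul, hy, zero_mul, map_zero]
  refine ⟨hinj, ?_⟩
  have := (isDualFamily_group ℂ G).finite
  have hfin := fun x => (isBlock_blockHom (G := G) x).equipped.frobeniusB.finite
  have h1 : Module.finrank ℂ (MonoidAlgebra ℂ G) =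
      Module.finrank ℂ (∀ x, ℂ ⊗[ℝ] (summand G x).B) := by
    have h2 := (blockEquiv (G := G)).toLinearEquiv.finrank_eq
    have h3 : Module.finrank ℝ (∀ x, (summand G x).B) = _ := Module.finrank_pi_fintype ℝ
    rw [Module.finrank_pi_fintype]
    simp only [Module.finrank_baseChange]
    rw [← h3]
    refine Eq.trans ?_ h2
    exact ((MonoidAlgebra.coeffLinearEquiv ℂ).finrank_eq.trans
      (Module.finrank_finsupp_self ℂ)).trans ((MonoidAlgebra.coeffLinearEquiv ℝ).finrank_eq.trans
      (Module.finrank_finsupp_self ℝ)).symm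
  exact (LinearMap.injective_iff_surjective_of_finrank_eq_finrank
    (V₂ := ∀ x, ℂ ⊗[ℝ] (summand G x).B) h1
    (f := (complexBlockHom (G := G)).toLinearMap)).1 hinj

lemma nonempty_iso_complex : Nonempty (EquippedData.Iso (regular ℂ G)
    (EquippedData.directSum fun x => (summand G x).complexify)) := by
  have hcard : (Fintype.card G : ℂ) ≠ 0 := by exact_mod_cast Fintype.card_ne_zero
  exact EquippedData.exists_iso_of_equivB (H := regular ℂ G)
    (regular_isStarCardyFrobenius ℂ G hcard)
    (EquippedData.IsEquippedCardyFrobenius.directSum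
      fun x => (isBlock_blockHom x).equipped.complexify).isStarCardyFrobenius
    (regular_φ_injective ℂ G)
    (EquippedData.directSum_φ_injective
      fun x => EquippedData.complexify_φ_injective (isBlock_blockHom x).φ_injective)
    (AlgEquiv.ofBijective _ complexBlockHom_bijective) lB_complexBlockHom complexBlockHom_antipode

end Real

end CardyFrobenius

theorem mainTheorem1 (G : Type*) [Group G] [Fintype G] :
    (CardyFrobenius.regular ℝ G).IsEquippedCardyFrobenius ∧
    (CardyFrobenius.regular ℂ G).IsEquippedCardyFrobenius ∧
    (∀ x : Σ D : CardyFrobenius.DivType, CardyFrobenius.Ir G D,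
      (CardyFrobenius.summand G x).IsEquippedCardyFrobenius) ∧
    ∃ _ : Fintype (Σ D : CardyFrobenius.DivType, CardyFrobenius.Ir G D),
      Nonempty (CardyFrobenius.EquippedData.Iso
        (CardyFrobenius.regular ℝ G)
        (CardyFrobenius.EquippedData.directSum (CardyFrobenius.summand G))) ∧
      Nonempty (CardyFrobenius.EquippedData.Iso
        (CardyFrobenius.regular ℂ G)
        (CardyFrobenius.EquippedData.directSum
          fun x => (CardyFrobenius.summand G x).complexify)) := by
  have := CardyFrobenius.finite_irreps G
  let F : Fintype (Σ D : CardyFrobenius.DivType, CardyFrobenius.Ir G D) := Fintype.ofFinite _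
  have h := fun x => (CardyFrobenius.isBlock_blockHom (G := G) x).equipped
  have hR : (Fintype.card G : ℝ) ≠ 0 := by exact_mod_cast Fintype.card_ne_zero
  have hC : (Fintype.card G : ℂ) ≠ 0 := by exact_mod_cast Fintype.card_ne_zero
  have eR := CardyFrobenius.nonempty_iso_real (G := G)
  have eC := CardyFrobenius.nonempty_iso_complex (G := G)
  -- For the group algebras `U² = K_A⋆` is inherited from the direct sums through the isomorphisms,
  -- which were built without using it for the group algebras.
  exact ⟨eR.some.isEquipped (CardyFrobenius.regular_isStarCardyFrobenius ℝ G hR)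
      (CardyFrobenius.EquippedData.IsEquippedCardyFrobenius.directSum h),
    eC.some.isEquipped (CardyFrobenius.regular_isStarCardyFrobenius ℂ G hC)
      (CardyFrobenius.EquippedData.IsEquippedCardyFrobenius.directSum fun x => (h x).complexify),
    h, F, eR, eC⟩
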